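/- Conventions. A compact quantum metric space $(\mathfrak A,\mathsf L)$ is a unital C*-algebra with a seminorm $\mathsf L:\mathfrak{sa}(\mathfrak A)\to[0,\infty]$ that is lower semicontinuous for the C*-norm, has dense domain $\{\mathsf L<\infty\}$ and kernel $\mathbb R1_{\mathfrak A}$, and whose Monge-Kantorovich metric $\mathsf{mk}_{\mathsf L}(\varphi,\psi)=\sup\{|\varphi(a)-\psi(a)|:\mathsf L(a)\le1\}$ metrizes the weak* topology of the state space $\mathscr S(\mathfrak A)$; then $\mathsf L$ is called a Lip-norm. It is $(C,D)$-quasi-Leibniz ($C\ge1$, $D\ge0$) if for all $a,b$ in its domain both $\mathsf L\left(\frac{ab+ba}{2}\right)$ and $\mathsf L\left(\frac{ab-ba}{2i}\right)$ are at most $C(\|a\|\mathsf L(b)+\|b\|\mathsf L(a))+D\,\mathsf L(a)\mathsf L(b)$, and quasi-Leibniz if this holds for some such $C,D$. A bridge $\gamma=(\mathfrak D,\omega,\pi_{\mathfrak A},\pi_{\mathfrak B})$ from $\mathfrak A$ to $\mathfrak B$ consists of a unital C*-algebra $\mathfrak D$, an element $\omega\in\mathfrak D$ for which the set $\mathscr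 S_1(\mathfrak D|\omega)$ of the states $\varphi$ of $\mathfrak D$ with $\varphi((1-\omega)^*(1-\omega))=\varphi((1-\omega)(1-\omega)^*)=0$ is not empty, and unital injective *-homomorphisms $\pi_{\mathfrak A}:\mathfrak A\to\mathfrak D$, $\pi_{\mathfrak B}:\mathfrak B\to\mathfrak D$. Its length with respect to $\mathsf L_{\mathfrak A},\mathsf L_{\mathfrak B}$ is the maximum of the Hausdorff distance in $\mathfrak D$ between $\{\pi_{\mathfrak A}(a)\omega:\mathsf L_{\mathfrak A}(a)\le1\}$ and $\{\omega\pi_{\mathfrak B}(b):\mathsf L_{\mathfrak B}(b)\le1\}$, and of the Hausdorff distances between $\mathscr S(\mathfrak A)$ and $\{\varphi\circ\pi_{\mathfrak A}:\varphi\in\mathscr S_1(\mathfrak D|\omega)\}$ for $\mathsf{mk}_{\mathsf L_{\mathfrak A}}$ and between $\mathscr S(\mathfrak B)$ and $\{\varphi\circ\pi_{\mathfrak B}:\varphi\in\mathscr S_1(\mathfrak D|\omega)\}$ for $\mathsf{mk}_{\mathsf L_{\mathfrak B}}$. The quantum Gromov-Hausdorff propinquity $\mathsf\Lambda$ of two quasi-Leibniz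 compact quantum metric spaces is the infimum, over all finite chains of bridges through quasi-Leibniz compact quantum metric spaces that join them, of the sum of the lengths of the bridges. Let $\mathfrak A=\bigoplus_{l=0}^nM_{m_l}(\mathbb C)$ with $n\in\mathbb N$, $m_l\in\mathbb N\setminus\{0\}$, and let $m_{\mathfrak A}=\max_lm_l$. For $a=(a^l_{j,k})\in\mathfrak{sa}(\mathfrak A)$ let $\|a\|_{\infty,\mathfrak A_{\mathbb R}}=\max_{l,j,k}\max\{|\mathrm{Re}\,a^l_{j,k}|,|\mathrm{Im}\,a^l_{j,k}|\}$. For a nonempty compact metric space $(Y,\mathsf d)$ and $a\in\mathfrak{sa}(C(Y,\mathfrak A))$ let $$\mathsf L_{Y}(a)=\max\left\{\sup_{x\ne y}\frac{\|a(x)-a(y)\|_{\infty,\mathfrak A_{\mathbb R}}}{\mathsf d(x,y)},\ \inf_{r\in\mathbb R}\sup_{x\in Y}\|a(x)-r1_{\mathfrak A}\|_{\infty,\mathfrak A_{\mathbb R}}\right\}.$$ Corollary. For every nonempty compact metric space $(X,\mathsf d_X)$ there is a sequence $(X_k)_{k\in\mathbb N}$ of nonempty finite subsets of $X$, with the metric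 of $X$, such that $$\lim_{k\to\infty}\mathsf\Lambda\big((C(X_k,\mathfrak A),\mathsf L_{X_k}),(C(X,\mathfrak A),\mathsf L_X)\big)=0.$$ Moreover every $C(X_k,\mathfrak A)$ is finite-dimensional, and all the $\mathsf L_{X_k}$ as well as $\mathsf L_X$ are $(\sqrt2\,m_{\mathfrak A},0)$-quasi-Leibniz Lip-norms; so $C(X,\mathfrak A)$ with a $(\sqrt2\,m_{\mathfrak A},0)$-quasi-Leibniz Lip-norm is a limit in propinquity of finite-dimensional C*-algebras with $(\sqrt2\,m_{\mathfrak A},0)$-quasi-Leibniz Lip-norms. -/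

import Mathlib

open Filter Topology
open scoped ENNReal NNReal ComplexOrder Matrix.Norms.L2Operator

universe u

noncomputable section

namespace QuantumMetric

section LipNorms

variable {A : Type u} [CStarAlgebra A]

/-- The states of a unital C*-algebra: positive linear functionals of value `1` at the unit.
The subtype topology inherited from `WeakDual` is the weak* topology. -/
def StateSpace (A : Type u) [CStarAlgebra A] : Set (WeakDual ℂ A) :=
  {φ | φ 1 = 1 ∧ ∀ a : A, 0 ≤ φ (star a * a)}

/-- The Monge-Kantorovich (extended) distance between two states. -/
def mkDist (L : selfAdjoint A → ℝ≥0∞) (φ ψ : StateSpace A) : ℝ≥0∞ :=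
  ⨆ (a : selfAdjoint A) (_ : L a ≤ 1), ‖φ.1 (a : A) - ψ.1 (a : A)‖ₑ

/-- The Jordan product `(ab + ba) / 2`. -/
def jordan (a b : selfAdjoint A) : selfAdjoint A :=
  ⟨(2 : ℂ)⁻¹ • ((a : A) * b + b * a), by
    rw [selfAdjoint.mem_iff]
    simp [star_smul, selfAdjoint.star_val_eq, add_comm]⟩

/-- The Lie product `(ab - ba) / (2i)`. -/
def lie (a b : selfAdjoint A) : selfAdjoint A :=
  ⟨(2 * Complex.I)⁻¹ • ((a : A) * b - b * a), by
    rw [selfAdjoint.mem_iff]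
    simp [star_smul, selfAdjoint.star_val_eq, smul_sub, add_comm]⟩

/-- `L` is a Lip-norm, i.e. `(A, L)` is a compact quantum metric space. The value `∞` is allowed
for `L`, and `0 * ∞ = 0` in `ℝ≥0∞`. -/
structure IsLipNorm (L : selfAdjoint A → ℝ≥0∞) : Prop where
  add_le : ∀ a b, L (a + b) ≤ L a + L b
  smul : ∀ (t : ℝ) (a), L (t • a) = ‖t‖ₑ * L a
  dense_dom : Dense {a | L a < ∞}
  eq_zero_iff : ∀ a, L a = 0 ↔ ∃ t : ℝ, a = t • (1 : selfAdjoint A)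
  mkDist_ne_top : ∀ φ ψ : StateSpace A, mkDist L φ ψ ≠ ∞
  /-- the metric `mkDist L` induces the weak* topology on the state space -/
  nhds_basis : ∀ φ : StateSpace A,
    (𝓝 φ).HasBasis (fun ε : ℝ≥0∞ => 0 < ε) (fun ε => {ψ | mkDist L φ ψ < ε})
  lsc : LowerSemicontinuous L

/-- `L` is a `(C, D)`-quasi-Leibniz Lip-norm. -/
structure IsQuasiLeibnizLipNorm (C D : ℝ) (L : selfAdjoint A → ℝ≥0∞) : Prop
    extends IsLipNorm L where
  one_le : 1 ≤ C
  nonneg : 0 ≤ D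
  leibniz : ∀ a b, L a < ∞ → L b < ∞ →
    max (L (jordan a b)) (L (lie a b)) ≤
      ENNReal.ofReal C * (‖(a : A)‖ₑ * L b + ‖(b : A)‖ₑ * L a) + ENNReal.ofReal D * L a * L b

end LipNorms

section Propinquity

/-- A unital C*-algebra with a `[0, ∞]`-valued function on its self-adjoint part. -/
structure LipPair : Type (u + 1) where
  carrier : Type u
  [cstar : CStarAlgebra carrier]
  lip : selfAdjoint carrier → ℝ≥0∞

attribute [instance] LipPair.cstar

/-- The pair is a quasi-Leibniz compact quantum metric space. -/
def LipPair.IsQuasiLeibniz (P : LipPair.{u}) : Prop :=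
  ∃ C D : ℝ, IsQuasiLeibnizLipNorm C D P.lip

/-- The set of self-adjoint elements of Lip-norm at most `1`. -/
def LipPair.lipBall (P : LipPair.{u}) : Set P.carrier :=
  {a | ∃ b : selfAdjoint P.carrier, P.lip b ≤ 1 ∧ (b : P.carrier) = a}

/-- The `1`-level set of an element of a unital C*-algebra. -/
def levelOne {D : Type u} [CStarAlgebra D] (ω : D) : Set (StateSpace D) :=
  {φ | φ.1 (star (1 - ω) * (1 - ω)) = 0 ∧ φ.1 ((1 - ω) * star (1 - ω)) = 0}

/-- A bridge between two unital C*-algebras. -/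
structure Bridge (A B : Type u) [CStarAlgebra A] [CStarAlgebra B] : Type (u + 1) where
  space : Type u
  [cstar : CStarAlgebra space]
  pivot : space
  levelOne_nonempty : (levelOne pivot).Nonempty
  left : A →⋆ₐ[ℂ] space
  right : B →⋆ₐ[ℂ] space
  left_injective : Function.Injective left
  right_injective : Function.Injective right

attribute [instance] Bridge.cstar

/-- The set of states of `A` that are pullbacks under `π` of states in `K`. -/
def pullbackStates {A D : Type u} [CStarAlgebra A] [CStarAlgebra D] (π : A →⋆ₐ[ℂ] D)
    (K : Set (StateSpace D)) : Set (StateSpace A) :=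
  {ψ | ∃ φ ∈ K, ∀ a : A, ψ.1 a = φ.1 (π a)}

/-- The Hausdorff (extended) distance between two sets with respect to a distance function. -/
def hausdorffOf {S : Type*} (d : S → S → ℝ≥0∞) (s t : Set S) : ℝ≥0∞ :=
  max (⨆ x ∈ s, ⨅ y ∈ t, d x y) (⨆ y ∈ t, ⨅ x ∈ s, d x y)

variable {P Q : LipPair.{u}}

/-- The reach of a bridge: the Hausdorff distance, in the C*-norm, between the sets
`π_A(a) ω` and `ω π_B(b)` for `a`, `b` in the two Lip-balls. -/
def Bridge.reach (γ : Bridge P.carrier Q.carrier) : ℝ≥0∞ :=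
  Metric.hausdorffEDist ((fun a => γ.left a * γ.pivot) '' P.lipBall)
    ((fun b => γ.pivot * γ.right b) '' Q.lipBall)

/-- The height of a bridge. -/
def Bridge.height (γ : Bridge P.carrier Q.carrier) : ℝ≥0∞ :=
  max (hausdorffOf (mkDist P.lip) Set.univ (pullbackStates γ.left (levelOne γ.pivot)))
    (hausdorffOf (mkDist Q.lip) Set.univ (pullbackStates γ.right (levelOne γ.pivot)))

/-- The length of a bridge. -/
def Bridge.length (γ : Bridge P.carrier Q.carrier) : ℝ≥0∞ :=
  max γ.reach γ.height

/-- A trek: a finite nonempty chain of bridges whose vertices are all quasi-Leibniz compact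
quantum metric spaces. -/
inductive Trek : LipPair.{u} → LipPair.{u} → Type (u + 1)
  | single {P Q : LipPair.{u}} (hP : P.IsQuasiLeibniz) (hQ : Q.IsQuasiLeibniz)
      (γ : Bridge P.carrier Q.carrier) : Trek P Q
  | cons {P Q R : LipPair.{u}} (hP : P.IsQuasiLeibniz)
      (γ : Bridge P.carrier Q.carrier) (T : Trek Q R) : Trek P R

/-- The length of a trek: the sum of the lengths of its bridges. -/
def Trek.length : {P Q : LipPair.{u}} → Trek P Q → ℝ≥0∞
  | _, _, .single _ _ γ => γ.length
  | _, _, .cons _ γ T => γ.length + T.length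

/-- The quantum Gromov-Hausdorff propinquity. -/
def propinquity (P Q : LipPair.{u}) : ℝ≥0∞ := ⨅ T : Trek P Q, T.length

end Propinquity

section Homogeneous

/-- The direct sum of the matrix algebras `M_{m 0}(ℂ), …, M_{m n}(ℂ)`, with entrywise operations
and the maximum of the operator norms on the Hilbert spaces `ℂ ^ (m l)`. -/
abbrev MatrixSum {n : ℕ} (m : Fin (n + 1) → ℕ) : Type :=
  ∀ l : Fin (n + 1), Matrix (Fin (m l)) (Fin (m l)) ℂ

/-- The largest of the matrix sizes. -/
def maxSize {n : ℕ} (m : Fin (n + 1) → ℕ) : ℕ := Finset.univ.sup m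

/-- The maximum of `|Re|` and `|Im|` over all the matrix entries. -/
def entryNorm {n : ℕ} {m : Fin (n + 1) → ℕ} (a : MatrixSum m) : ℝ≥0 :=
  Finset.univ.sup fun l => Finset.univ.sup fun j => Finset.univ.sup fun k =>
    max ‖(a l j k).re‖₊ ‖(a l j k).im‖₊

variable (X : Type u) [MetricSpace X] [CompactSpace X] {n : ℕ} (m : Fin (n + 1) → ℕ)

/-- The Lipschitz constant of `a` with respect to `entryNorm`. -/
def lipConst (a : C(X, MatrixSum m)) : ℝ≥0∞ :=
  ⨆ (x : X) (y : X) (_ : x ≠ y), (entryNorm (a x - a y) : ℝ≥0∞) / edist x y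

/-- The distance of `a` to the real scalars, in the supremum norm induced by `entryNorm`. -/
def distScalars (a : C(X, MatrixSum m)) : ℝ≥0∞ :=
  ⨅ r : ℝ, ⨆ x : X, (entryNorm (a x - (r : ℂ) • (1 : MatrixSum m)) : ℝ≥0∞)

/-- The C*-algebra `C(X, 𝔄)`, where `𝔄` is the direct sum of matrix algebras of sizes `m`,
with the maximum of `lipConst` and `distScalars`. -/
def homogeneous : LipPair.{u} where
  carrier := C(X, MatrixSum m)
  lip a := max (lipConst X m a) (distScalars X m a)

end Homogeneous

end QuantumMetric

end

/-! A finite `δ`-net `S` of `X` nearly determines the Lip-ball over `X`. The comparison takes place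
over the compact set of pairs `(y, x)` in `S × X` with `dist y x ≤ δ`: both algebras embed by
pullback along the two projections (`nearBridge`), with pivot `1`. Since contractive unital
functionals are states, Hahn-Banach extends every state along an embedding, so the height vanishes
and only the reach remains.

For the reach, an element of the Lip-ball over `X` is restricted to `S`. Conversely, an element of
the Lip-ball over `S` is extended entry by entry with McShane's theorem, clamped around a scalar and
symmetrized (`exists_extension_lip_le_one`). The entry norm makes this possible: it reduces the
problem to real functions, which extend with the same Lipschitz constant. Returning to the C*-norm
costs the factor `√2 * maxSize m`, so the propinquity is at most `√2 * maxSize m * 2δ`.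

The Lip-norm property follows Rieffel's criterion: the domain is dense, and modulo scalars the
Lip-ball is bounded and equi-Lipschitz, hence totally bounded by Arzelà-Ascoli. The Leibniz
inequality is a telescoping estimate in the operator norm, and the same factor reappears as its
constant. -/

namespace QuantumMetric

/-! ### States: contractivity, extension, and bridges with unit pivot. -/

section States

variable {A : Type u} [CStarAlgebra A]

/-- States are contractive. -/
theorem norm_state_apply_le (φ : StateSpace A) (a : A) : ‖φ.1 a‖ ≤ ‖a‖ := by
  let _ : PartialOrder A := CStarAlgebra.spectralOrder A
  have _ : StarOrderedRing A := CStarAlgebra.spectralOrderedRing A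
  obtain ⟨φ, h1, hpos⟩ := φ
  -- In the GNS space `φ a` is the inner product of the classes of `1` and `a`, so Cauchy-Schwarz
  -- suffices once `star b * b ≤ ‖b‖ ^ 2` bounds the GNS norm by the C*-norm.
  let f : A →ₚ[ℂ] ℂ := PositiveLinearMap.mk₀ (φ : A →ₗ[ℂ] ℂ) (fun b hb => by
    obtain ⟨c, rfl⟩ := CStarAlgebra.nonneg_iff_eq_star_mul_self.1 hb
    exact hpos c)
  have hf : ∀ b, f b = φ b := fun _ => rfl
  have hnorm : ∀ b : A, ‖f.toPreGNS b‖ ≤ ‖b‖ := by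
    intro b
    have hle : f (star b * b) ≤ f (algebraMap ℝ A ‖star b * b‖) :=
      OrderHomClass.mono f (IsSelfAdjoint.le_algebraMap_norm_self (.star_mul_self b))
    have h2 : f (algebraMap ℝ A ‖star b * b‖) = ((‖b‖ * ‖b‖ : ℝ) : ℂ) := by
      rw [hf, IsScalarTower.algebraMap_apply ℝ ℂ A, Algebra.algebraMap_eq_smul_one, map_smul, h1,
        CStarRing.norm_star_mul_self]
      simp
    have h3 := f.preGNS_norm_sq (f.toPreGNS b)
    rw [f.ofPreGNS_toPreGNS] at h3
    rw [h2, ← h3, pow_two] at hle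
    have h4 : ‖f.toPreGNS b‖ * ‖f.toPreGNS b‖ ≤ ‖b‖ * ‖b‖ := by exact_mod_cast hle
    exact (mul_self_le_mul_self_iff (norm_nonneg _) (norm_nonneg _)).2 h4
  have hin : inner ℂ (f.toPreGNS 1) (f.toPreGNS a) = φ a := by
    rw [f.preGNS_inner_def]; simp [hf]
  have hone : ‖f.toPreGNS 1‖ ≤ 1 := by
    have h3 := f.preGNS_norm_sq (f.toPreGNS 1)
    rw [f.ofPreGNS_toPreGNS] at h3
    have h4 : ‖f.toPreGNS 1‖ ^ 2 = 1 := by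
      have : ((‖f.toPreGNS 1‖ : ℂ)) ^ 2 = 1 := by rw [h3]; simp [hf, h1]
      exact_mod_cast this
    nlinarith [norm_nonneg (f.toPreGNS 1)]
  calc ‖φ a‖ = ‖inner ℂ (f.toPreGNS 1) (f.toPreGNS a)‖ := by rw [hin]
    _ ≤ ‖f.toPreGNS 1‖ * ‖f.toPreGNS a‖ := norm_inner_le_norm _ _
    _ ≤ 1 * ‖a‖ := by gcongr; exact hnorm a
    _ = ‖a‖ := one_mul _

theorem enorm_state_apply_le (φ : StateSpace A) (a : A) : ‖φ.1 a‖ₑ ≤ ‖a‖ₑ := by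
  simpa only [enorm_le_iff_norm_le] using norm_state_apply_le φ a

/-- A contractive unital functional takes real values on self-adjoint elements. -/
theorem im_apply_eq_zero_of_norm_le {φ : WeakDual ℂ A} (h1 : φ 1 = 1) (hφ : ∀ a, ‖φ a‖ ≤ ‖a‖)
    {a : A} (ha : IsSelfAdjoint a) : (φ a).im = 0 := by
  have _ : Nontrivial A := by
    by_contra hA
    rw [not_nontrivial_iff_subsingleton] at hA
    rw [Subsingleton.elim (1 : A) 0, map_zero] at h1
    exact zero_ne_one h1
  -- Testing on `a + it`: the squared norm is at most `‖a‖ ^ 2 + t ^ 2`, while the left side has a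
  -- cross term linear in `t`, which must therefore vanish.
  have key : ∀ t : ℝ, ((φ a).im + t) ^ 2 ≤ ‖a‖ ^ 2 + t ^ 2 := by
    intro t
    have e1 : φ (a + (t * Complex.I) • 1) = φ a + t * Complex.I := by
      rw [map_add, map_smul, h1]; simp
    have e2 : ‖a + (t * Complex.I) • (1 : A)‖ ^ 2 ≤ ‖a‖ ^ 2 + t ^ 2 := by
      rw [pow_two, ← CStarRing.norm_star_mul_self]
      have : star (a + (t * Complex.I) • (1 : A)) * (a + (t * Complex.I) • (1 : A))
          = a * a + ((t : ℂ) ^ 2) • (1 : A) := by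
        simp only [star_add, ha.star_eq, star_smul, star_one, add_mul, mul_add, smul_mul_assoc,
          mul_smul_comm, one_mul, mul_one, star_mul', Complex.star_def,
          Complex.conj_ofReal, Complex.conj_I]
        have h3 : (t * Complex.I) * (t * -Complex.I) = (t : ℂ) ^ 2 := by
          linear_combination (-(t : ℂ) ^ 2) * Complex.I_mul_I
        rw [smul_add, smul_smul, h3, mul_neg, neg_smul]
        abel
      rw [this]
      calc _ ≤ ‖a * a‖ + ‖((t : ℂ) ^ 2) • (1 : A)‖ := norm_add_le _ _
        _ ≤ ‖a‖ * ‖a‖ + t ^ 2 := by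
          gcongr
          · exact norm_mul_le _ _
          · rw [norm_smul]; simp
        _ = _ := by ring
    have e3 := hφ (a + (t * Complex.I) • 1)
    rw [e1] at e3
    have e4 : |(φ a).im + t| ≤ ‖φ a + t * Complex.I‖ := by
      simpa using Complex.abs_im_le_norm (φ a + t * Complex.I)
    calc ((φ a).im + t) ^ 2 = |(φ a).im + t| ^ 2 := (sq_abs _).symm
      _ ≤ ‖a + (t * Complex.I) • (1 : A)‖ ^ 2 := by gcongr; exact e4.trans e3
      _ ≤ _ := e2
  by_contra h
  -- This `t` makes the cross term equal to `‖a‖ ^ 2 + 1`, which is too large.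
  have := key ((‖a‖ ^ 2 + 1) / (2 * (φ a).im))
  have h5 : (φ a).im * ((‖a‖ ^ 2 + 1) / (2 * (φ a).im)) = (‖a‖ ^ 2 + 1) / 2 := by
    field_simp
  nlinarith [sq_nonneg (φ a).im]

/-- A contractive unital functional is a state. -/
theorem mem_stateSpace_of_norm_le {φ : WeakDual ℂ A} (h1 : φ 1 = 1) (hφ : ∀ a, ‖φ a‖ ≤ ‖a‖) :
    φ ∈ StateSpace A := by
  refine ⟨h1, fun a => ?_⟩
  let _ : PartialOrder A := CStarAlgebra.spectralOrder A
  have _ : StarOrderedRing A := CStarAlgebra.spectralOrderedRing A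
  set p := star a * a with hp
  have hsa : IsSelfAdjoint p := .star_mul_self a
  have him := im_apply_eq_zero_of_norm_le h1 hφ hsa
  -- From `0 ≤ ‖p‖ - p ≤ ‖p‖` and contractivity, `φ p` lies within `‖p‖` of `‖p‖`, so its real part
  -- is nonnegative.
  have hle : ‖algebraMap ℝ A ‖p‖ - p‖ ≤ ‖algebraMap ℝ A ‖p‖‖ :=
    CStarAlgebra.norm_le_norm_of_nonneg_of_le (sub_nonneg.2 hsa.le_algebraMap_norm_self)
      (sub_le_self _ (star_mul_self_nonneg a))
  have h2 : ‖algebraMap ℝ A ‖p‖‖ ≤ ‖p‖ := by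
    nontriviality A
    rw [norm_algebraMap']; simp
  have h3 : φ (algebraMap ℝ A ‖p‖ - p) = ‖p‖ - φ p := by
    rw [map_sub, IsScalarTower.algebraMap_apply ℝ ℂ A, Algebra.algebraMap_eq_smul_one, map_smul, h1]
    simp
  have h4 := (Complex.abs_re_le_norm _).trans ((hφ (algebraMap ℝ A ‖p‖ - p)).trans (hle.trans h2))
  rw [h3] at h4
  simp only [Complex.sub_re, Complex.ofReal_re] at h4
  rw [Complex.nonneg_iff]
  exact ⟨by linarith [(abs_le.1 h4).2], him.symm⟩

theorem stateSpace_nonempty [Nontrivial A] : Nonempty (StateSpace A) := by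
  obtain ⟨g, hg, hg1⟩ := exists_dual_vector ℂ (1 : A) (by simp)
  refine ⟨⟨(g : WeakDual ℂ A), mem_stateSpace_of_norm_le ?_ fun a => ?_⟩⟩
  · exact hg1.trans (by simp)
  · exact (g.le_opNorm a).trans (by rw [hg, one_mul])

variable {D : Type u} [CStarAlgebra D]

/-- States extend along injective unital star homomorphisms. -/
theorem pullbackStates_univ (π : A →⋆ₐ[ℂ] D) (hπ : Function.Injective π) :
    pullbackStates π Set.univ = Set.univ := by
  refine Set.eq_univ_of_forall fun ψ => ?_
  have hiso : ∀ a, ‖π a‖ = ‖a‖ := NonUnitalStarAlgHom.norm_map π hπ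
  let i : A →ₗᵢ[ℂ] D := ⟨(π : A →ₗ[ℂ] D), hiso⟩
  let e := i.equivRange
  let ψ' : StrongDual ℂ A := ψ.1
  obtain ⟨g, hg, hgn⟩ := exists_extension_norm_eq (LinearMap.range i.toLinearMap)
    (ψ'.comp (e.symm : _ →L[ℂ] A))
  have hgπ : ∀ a, g (π a) = ψ.1 a := by
    intro a
    have h := hg (e a)
    rw [ContinuousLinearMap.comp_apply] at h
    exact h.trans (congrArg ψ' (e.symm_apply_apply a))
  have hn : ‖g‖ ≤ 1 := by
    rw [hgn]
    refine ContinuousLinearMap.opNorm_le_bound _ zero_le_one fun x => ?_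
    rw [one_mul]
    exact (norm_state_apply_le ψ (e.symm x)).trans (e.symm.norm_map x).le
  refine ⟨⟨(g : WeakDual ℂ D), mem_stateSpace_of_norm_le ?_ fun a => ?_⟩, trivial, fun a => ?_⟩
  · exact (congrArg g (map_one π).symm).trans ((hgπ 1).trans ψ.2.1)
  · exact (g.le_opNorm a).trans (mul_le_of_le_one_left (norm_nonneg _) hn)
  · exact (hgπ a).symm

theorem levelOne_one : levelOne (1 : D) = Set.univ := by
  ext φ; simp [levelOne]

theorem mkDist_self (L : selfAdjoint A → ℝ≥0∞) (φ : StateSpace A) : mkDist L φ φ = 0 := by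
  simp [mkDist]

theorem hausdorffOf_self {S : Type*} {d : S → S → ℝ≥0∞} (hd : ∀ x, d x x = 0) (s : Set S) :
    hausdorffOf d s s = 0 := by
  have h : ∀ x ∈ s, (⨅ y ∈ s, d x y) = 0 ∧ (⨅ y ∈ s, d y x) = 0 := fun x hx =>
    ⟨le_antisymm ((iInf₂_le x hx).trans (hd x).le) zero_le,
      le_antisymm ((iInf₂_le x hx).trans (hd x).le) zero_le⟩
  simp only [hausdorffOf]
  refine le_antisymm (max_le ?_ ?_) zero_le
  · exact iSup₂_le fun x hx => (h x hx).1.le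
  · exact iSup₂_le fun x hx => (h x hx).2.le

/-- A bridge whose pivot is the unit has height `0`. -/
theorem height_eq_zero_of_pivot_eq_one {P Q : LipPair.{u}} (γ : Bridge P.carrier Q.carrier)
    (h : γ.pivot = 1) : γ.height = 0 := by
  rw [Bridge.height, h, levelOne_one, pullbackStates_univ _ γ.left_injective,
    pullbackStates_univ _ γ.right_injective, hausdorffOf_self (mkDist_self _),
    hausdorffOf_self (mkDist_self _), max_self]

end States

/-! ### Rieffel's criterion: total boundedness modulo scalars and the weak* topology. -/

section TotallyBounded

theorem exists_nnreal_add_add_lt {ε : ℝ≥0∞} (hε : 0 < ε) :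
    ∃ δ : ℝ≥0, 0 < δ ∧ (δ + δ + δ : ℝ≥0∞) < ε := by
  obtain ⟨η, hη0, hη⟩ := ENNReal.lt_iff_exists_nnreal_btwn.1 hε
  refine ⟨η / 3, by simpa using hη0, lt_of_eq_of_lt ?_ hη⟩
  rw [← ENNReal.coe_add, ← ENNReal.coe_add, ENNReal.coe_inj, ← add_div, ← add_div]
  field_simp
  norm_num

variable {A : Type u} [CStarAlgebra A]

theorem edist_state_apply_le (φ ψ : StateSpace A) (a : A) :
    ‖φ.1 a - ψ.1 a‖ₑ ≤ ‖a‖ₑ + ‖a‖ₑ :=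
  enorm_sub_le.trans (add_le_add (enorm_state_apply_le φ a) (enorm_state_apply_le ψ a))

/-- The difference of two states is insensitive to scalar translations. -/
theorem state_sub_apply_sub_smul_one (φ ψ : StateSpace A) (a : A) (r : ℂ) :
    φ.1 (a - r • 1) - ψ.1 (a - r • 1) = φ.1 a - ψ.1 a := by
  simp only [map_sub, map_smul, φ.2.1, ψ.2.1]
  ring

theorem le_mkDist {L : selfAdjoint A → ℝ≥0∞} (φ ψ : StateSpace A) {a : selfAdjoint A}
    (ha : L a ≤ 1) : ‖φ.1 (a : A) - ψ.1 (a : A)‖ₑ ≤ mkDist L φ ψ :=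
  le_iSup₂_of_le a ha le_rfl

variable {L : selfAdjoint A → ℝ≥0∞} {K : Set A}

/-- A difference of two states ignores scalar translations, so the supremum over the Lip-ball is
controlled by the bounded set `K`. -/
theorem mkDist_ne_top_of_totallyBounded (hK : TotallyBounded K)
    (hLK : ∀ a : selfAdjoint A, L a ≤ 1 → ∃ r : ℝ, (a : A) - (r : ℂ) • 1 ∈ K)
    (φ ψ : StateSpace A) : mkDist L φ ψ ≠ ∞ := by
  obtain ⟨R, hR⟩ := (Metric.isBounded_iff_subset_closedBall 0).1 hK.isBounded
  refine ne_top_of_le_ne_top (b := ENNReal.ofReal R + ENNReal.ofReal R) (by simp)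
    (iSup₂_le fun a ha => ?_)
  obtain ⟨r, hr⟩ := hLK a ha
  rw [← state_sub_apply_sub_smul_one φ ψ a r]
  have h1 : ‖(a : A) - (r : ℂ) • 1‖ₑ ≤ ENNReal.ofReal R := by
    rw [← ofReal_norm]
    exact ENNReal.ofReal_le_ofReal (by simpa using hR hr)
  exact (edist_state_apply_le φ ψ _).trans (add_le_add h1 h1)

/-- If the Lip-ball is totally bounded modulo scalars, then small Monge-Kantorovich balls are
weak* neighbourhoods. -/
theorem mkDist_ball_mem_nhds (hK : TotallyBounded K)
    (hLK : ∀ a : selfAdjoint A, L a ≤ 1 → ∃ r : ℝ, (a : A) - (r : ℂ) • 1 ∈ K)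
    (φ : StateSpace A) {ε : ℝ≥0∞} (hε : 0 < ε) : {ψ | mkDist L φ ψ < ε} ∈ 𝓝 φ := by
  obtain ⟨δ, hδ, hδε⟩ := exists_nnreal_add_add_lt hε
  -- Closeness on the finite net `t` is a weak* open condition; contractivity of the two states
  -- carries it from the net to all of `K`.
  obtain ⟨t, ht, hKt⟩ := Metric.totallyBounded_iff.1 hK δ hδ
  have hev : ∀ c ∈ t, ∀ᶠ ψ in 𝓝 φ, ‖φ.1 c - ψ.1 c‖ₑ < δ := by
    intro c _
    have hc : Continuous fun ψ : StateSpace A => ‖φ.1 c - ψ.1 c‖ₑ :=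
      (continuous_const.sub ((WeakDual.eval_continuous c).comp continuous_subtype_val)).enorm
    exact (hc.tendsto φ).eventually_lt_const (by simpa using hδ)
  filter_upwards [(Filter.eventually_all_finite ht).2 hev] with ψ hψ
  refine lt_of_le_of_lt (iSup₂_le fun a ha => ?_) hδε
  obtain ⟨r, hr⟩ := hLK a ha
  rw [← state_sub_apply_sub_smul_one φ ψ a r]
  set b := (a : A) - (r : ℂ) • 1
  obtain ⟨c, hc, hbc⟩ := Set.mem_iUnion₂.1 (hKt hr)
  have hbc' : ‖b - c‖ₑ ≤ δ := by
    rw [← edist_eq_enorm_sub, edist_dist, ← ENNReal.ofReal_coe_nnreal]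
    exact ENNReal.ofReal_le_ofReal (Metric.mem_ball.1 hbc).le
  calc ‖φ.1 b - ψ.1 b‖ₑ
      = ‖(φ.1 (b - c) - ψ.1 (b - c)) + (φ.1 c - ψ.1 c)‖ₑ := by
        congr 1; simp only [map_sub]; ring
    _ ≤ (‖b - c‖ₑ + ‖b - c‖ₑ) + ‖φ.1 c - ψ.1 c‖ₑ :=
        (enorm_add_le _ _).trans (add_le_add (edist_state_apply_le φ ψ _) le_rfl)
    _ ≤ δ + δ + δ := add_le_add (add_le_add hbc' hbc') (hψ c hc).le

theorem enorm_apply_sub_le_mul_mkDist (hsmul : ∀ (t : ℝ) a, L (t • a) = ‖t‖ₑ * L a)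
    (φ ψ : StateSpace A) {c : selfAdjoint A} {t : ℝ} (ht : 0 < t) (hc : L c ≤ ENNReal.ofReal t) :
    ‖φ.1 (c : A) - ψ.1 (c : A)‖ₑ ≤ ENNReal.ofReal t * mkDist L φ ψ := by
  have h1 : L (t⁻¹ • c) ≤ 1 := by
    rw [hsmul, Real.enorm_eq_ofReal (by positivity)]
    calc _ ≤ ENNReal.ofReal t⁻¹ * ENNReal.ofReal t := by gcongr
      _ = 1 := by
        rw [← ENNReal.ofReal_mul (by positivity), inv_mul_cancel₀ ht.ne', ENNReal.ofReal_one]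
  have h2 := le_mkDist φ ψ h1
  have h3 : (c : A) = ((t : ℂ)) • ((t⁻¹ • c : selfAdjoint A) : A) := by
    rw [selfAdjoint.val_smul, Complex.coe_smul, smul_smul, mul_inv_cancel₀ ht.ne', one_smul]
  rw [h3, map_smul, map_smul, ← smul_sub, enorm_smul]
  have h4 : ‖(t : ℂ)‖ₑ = ENNReal.ofReal t := by
    rw [← ofReal_norm, Complex.norm_real, Real.norm_of_nonneg ht.le]
  rw [h4]
  gcongr

/-- If the domain of `L` is dense, then convergence for the Monge-Kantorovich metric implies
weak* convergence. -/
theorem tendsto_apply_of_tendsto_mkDist (hsmul : ∀ (t : ℝ) a, L (t • a) = ‖t‖ₑ * L a)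
    (hdense : Dense {a | L a < ∞}) {φ : StateSpace A} {F : Filter (StateSpace A)}
    (hF : Tendsto (mkDist L φ) F (𝓝 0)) (a : selfAdjoint A) :
    Tendsto (fun ψ : StateSpace A => ψ.1 (a : A)) F (𝓝 (φ.1 (a : A))) := by
  rw [EMetric.tendsto_nhds]
  intro ε hε
  obtain ⟨δ, hδ, hδε⟩ := exists_nnreal_add_add_lt hε
  obtain ⟨c, hc, hac⟩ := Metric.dense_iff.1 hdense a δ hδ
  -- The summand `1` keeps the scale positive when `L c = 0`.
  obtain ⟨t, ht, hct⟩ : ∃ t : ℝ, 0 < t ∧ L c ≤ ENNReal.ofReal t := by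
    refine ⟨(L c).toReal + 1, by positivity, ?_⟩
    calc L c = ENNReal.ofReal (L c).toReal := (ENNReal.ofReal_toReal hac.ne).symm
      _ ≤ _ := ENNReal.ofReal_le_ofReal (by linarith)
  have hlim : Tendsto (fun ψ => ENNReal.ofReal t * mkDist L φ ψ) F (𝓝 0) := by
    simpa using ENNReal.Tendsto.const_mul hF (Or.inr ENNReal.ofReal_ne_top)
  have hca : ‖(a : A) - c‖ₑ ≤ δ := by
    rw [← edist_eq_enorm_sub, edist_dist, ← ENNReal.ofReal_coe_nnreal, dist_comm]
    exact ENNReal.ofReal_le_ofReal (Metric.mem_ball.1 hc).le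
  filter_upwards [hlim.eventually_lt_const (show (0 : ℝ≥0∞) < δ by simpa using hδ)] with ψ hψ
  refine lt_of_le_of_lt ?_ hδε
  rw [edist_comm, edist_eq_enorm_sub]
  calc ‖φ.1 (a : A) - ψ.1 (a : A)‖ₑ
      = ‖(φ.1 ((a : A) - c) - ψ.1 ((a : A) - c)) + (φ.1 (c : A) - ψ.1 (c : A))‖ₑ := by
        congr 1; simp only [map_sub]; ring
    _ ≤ (‖(a : A) - c‖ₑ + ‖(a : A) - c‖ₑ) + ‖φ.1 (c : A) - ψ.1 (c : A)‖ₑ :=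
        (enorm_add_le _ _).trans (add_le_add (edist_state_apply_le φ ψ _) le_rfl)
    _ ≤ δ + δ + δ := add_le_add (add_le_add hca hca)
        ((enorm_apply_sub_le_mul_mkDist hsmul φ ψ ht hct).trans hψ.le)

/-- If the domain of `L` is dense and the Lip-ball is totally bounded modulo scalars, then the
Monge-Kantorovich metric induces the weak* topology. -/
theorem nhds_basis_of_totallyBounded (hsmul : ∀ (t : ℝ) a, L (t • a) = ‖t‖ₑ * L a)
    (hdense : Dense {a | L a < ∞}) (hK : TotallyBounded K)
    (hLK : ∀ a : selfAdjoint A, L a ≤ 1 → ∃ r : ℝ, (a : A) - (r : ℂ) • 1 ∈ K)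
    (φ : StateSpace A) :
    (𝓝 φ).HasBasis (fun ε : ℝ≥0∞ => 0 < ε) (fun ε => {ψ | mkDist L φ ψ < ε}) := by
  -- `L` only sees self-adjoint elements, so pointwise convergence is checked on real and imaginary
  -- parts.
  have hF : comap (mkDist L φ) (𝓝 0) ≤ 𝓝 φ := by
    rw [nhds_subtype, ← tendsto_iff_comap]
    refine (WeakBilin.tendsto_iff_forall_eval_tendsto _ ContinuousLinearMap.coe_injective).2
      fun a => ?_
    have h := fun b => tendsto_apply_of_tendsto_mkDist hsmul hdense
      (tendsto_comap (f := mkDist L φ) (x := 𝓝 0)) b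
    have hsplit : ∀ ψ : StateSpace A,
        ψ.1 a = ψ.1 (realPart a : A) + Complex.I • ψ.1 (imaginaryPart a : A) := by
      intro ψ
      rw [← map_smul, ← map_add, realPart_add_I_smul_imaginaryPart]
    have h' := (h (realPart a)).add ((h (imaginaryPart a)).const_smul Complex.I)
    rw [← hsplit] at h'
    exact h'.congr fun ψ => (hsplit ψ).symm
  refine ⟨fun s => ⟨fun hs => ?_, fun ⟨ε, hε, hs⟩ => ?_⟩⟩
  · exact ((ENNReal.nhds_zero_basis.comap (mkDist L φ)).mem_iff).1 (hF hs)
  · exact mem_of_superset (mkDist_ball_mem_nhds hK hLK φ hε) hs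

end TotallyBounded

/-! ### The entry norm and its comparison with the operator norm. -/

section EntryNorm

/-- Cauchy-Schwarz bounds each squared coordinate of `A v` by `s ^ 2 * p * ‖v‖ ^ 2`; summing over
the `p` rows gives a second factor `p`. -/
theorem l2_opNorm_le_card_mul {p : ℕ} (A : Matrix (Fin p) (Fin p) ℂ) {s : ℝ} (hs : 0 ≤ s)
    (hA : ∀ j k, ‖A j k‖ ≤ s) : ‖A‖ ≤ s * p := by
  rw [Matrix.cstar_norm_def]
  refine ContinuousLinearMap.opNorm_le_bound _ (by positivity) fun v => ?_
  refine le_of_sq_le_sq ?_ (by positivity)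
  rw [EuclideanSpace.norm_sq_eq, mul_pow, EuclideanSpace.norm_sq_eq v]
  have hrow : ∀ j, ‖(Matrix.toEuclideanCLM (n := Fin p) (𝕜 := ℂ) A v) j‖ ^ 2
      ≤ s ^ 2 * (p * ∑ k, ‖v k‖ ^ 2) := by
    intro j
    have h1 : ‖(Matrix.toEuclideanCLM (n := Fin p) (𝕜 := ℂ) A v) j‖ ≤ s * ∑ k, ‖v k‖ := by
      rw [Matrix.ofLp_toEuclideanCLM, Matrix.mulVec, dotProduct, Finset.mul_sum]
      refine (norm_sum_le _ _).trans (Finset.sum_le_sum fun k _ => ?_)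
      rw [norm_mul]
      gcongr
      exact hA j k
    calc _ ≤ (s * ∑ k, ‖v k‖) ^ 2 := by gcongr
      _ = s ^ 2 * (∑ k, ‖v k‖) ^ 2 := by ring
      _ ≤ _ := by
        gcongr
        simpa using sq_sum_le_card_mul_sum_sq (s := Finset.univ) (f := fun k => ‖v k‖)
  calc _ ≤ ∑ _j : Fin p, s ^ 2 * (p * ∑ k, ‖v k‖ ^ 2) := Finset.sum_le_sum fun j _ => hrow j
    _ = _ := by simp; ring

theorem norm_entry_le_l2_opNorm {p : ℕ} (A : Matrix (Fin p) (Fin p) ℂ) (j k : Fin p) :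
    ‖A j k‖ ≤ ‖A‖ := by
  have h := A.l2_opNorm_mulVec (EuclideanSpace.single k 1)
  rw [PiLp.norm_single, norm_one, mul_one] at h
  refine le_trans ?_ h
  refine le_trans (le_of_eq ?_) (PiLp.norm_apply_le _ j)
  simp

variable {n : ℕ} {m : Fin (n + 1) → ℕ}

theorem entryNorm_le_iff {a : MatrixSum m} {c : ℝ≥0} :
    entryNorm a ≤ c ↔ ∀ l j k, |(a l j k).re| ≤ c ∧ |(a l j k).im| ≤ c := by
  simp only [entryNorm, Finset.sup_le_iff, Finset.mem_univ, true_imp_iff, max_le_iff,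
    ← NNReal.coe_le_coe, coe_nnnorm, Real.norm_eq_abs]

theorem abs_re_le_entryNorm (a : MatrixSum m) (l j k) : |(a l j k).re| ≤ entryNorm a :=
  (entryNorm_le_iff.1 le_rfl l j k).1

theorem abs_im_le_entryNorm (a : MatrixSum m) (l j k) : |(a l j k).im| ≤ entryNorm a :=
  (entryNorm_le_iff.1 le_rfl l j k).2

@[simp]
theorem entryNorm_zero : entryNorm (0 : MatrixSum m) = 0 :=
  le_antisymm (entryNorm_le_iff.2 fun l j k => by simp) zero_le

theorem entryNorm_add_le (a b : MatrixSum m) : entryNorm (a + b) ≤ entryNorm a + entryNorm b := by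
  refine entryNorm_le_iff.2 fun l j k => ?_
  simp only [Pi.add_apply, Matrix.add_apply, Complex.add_re, Complex.add_im, NNReal.coe_add]
  exact ⟨(abs_add_le _ _).trans (add_le_add (abs_re_le_entryNorm ..) (abs_re_le_entryNorm ..)),
    (abs_add_le _ _).trans (add_le_add (abs_im_le_entryNorm ..) (abs_im_le_entryNorm ..))⟩

theorem entryNorm_smul_le (t : ℝ) (a : MatrixSum m) :
    entryNorm (t • a) ≤ ‖t‖₊ * entryNorm a := by
  refine entryNorm_le_iff.2 fun l j k => ?_
  simp only [Pi.smul_apply, Matrix.smul_apply, Complex.smul_re, Complex.smul_im, smul_eq_mul,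
    abs_mul, NNReal.coe_mul, coe_nnnorm, Real.norm_eq_abs]
  exact ⟨by gcongr; exact abs_re_le_entryNorm .., by gcongr; exact abs_im_le_entryNorm ..⟩

theorem entryNorm_neg (a : MatrixSum m) : entryNorm (-a) = entryNorm a := by
  simp [entryNorm]

theorem entryNorm_star (a : MatrixSum m) : entryNorm (star a) = entryNorm a := by
  have h : ∀ b : MatrixSum m, entryNorm (star b) ≤ entryNorm b := fun b =>
    entryNorm_le_iff.2 fun l j k => by
      simpa [Matrix.star_apply] using entryNorm_le_iff.1 (le_refl (entryNorm b)) l k j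
  exact le_antisymm (h a) (by simpa using h (star a))

theorem entryNorm_sub_comm (a b : MatrixSum m) : entryNorm (a - b) = entryNorm (b - a) := by
  rw [← entryNorm_neg, neg_sub]

theorem entryNorm_le_nnnorm (a : MatrixSum m) : entryNorm a ≤ ‖a‖₊ := by
  refine entryNorm_le_iff.2 fun l j k => ?_
  have h : ‖a l j k‖ ≤ ‖a‖ := (norm_entry_le_l2_opNorm (a l) j k).trans (norm_le_pi_norm a l)
  exact ⟨(Complex.abs_re_le_norm _).trans h, (Complex.abs_im_le_norm _).trans h⟩

theorem entryNorm_le_enorm (a : MatrixSum m) : (entryNorm a : ℝ≥0∞) ≤ ‖a‖ₑ :=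
  ENNReal.coe_le_coe.2 (entryNorm_le_nnnorm a)

/-- The operator norm is at most `√2 · maxSize m` times the entry norm. -/
theorem norm_le_mul_entryNorm (a : MatrixSum m) : ‖a‖ ≤ √2 * maxSize m * entryNorm a := by
  refine (pi_norm_le_iff_of_nonneg (by positivity)).2 fun l => ?_
  have h : ∀ j k, ‖a l j k‖ ≤ √2 * entryNorm a := by
    intro j k
    refine (Complex.norm_le_sqrt_two_mul_max _).trans ?_
    gcongr
    exact max_le (abs_re_le_entryNorm ..) (abs_im_le_entryNorm ..)
  have hl : (m l : ℝ) ≤ maxSize m := by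
    exact_mod_cast (Finset.le_sup (f := m) (Finset.mem_univ l))
  calc ‖a l‖ ≤ √2 * entryNorm a * m l := l2_opNorm_le_card_mul _ (by positivity) h
    _ ≤ √2 * entryNorm a * maxSize m := by gcongr
    _ = _ := by ring

theorem enorm_le_mul_entryNorm (a : MatrixSum m) :
    ‖a‖ₑ ≤ ENNReal.ofReal (√2 * maxSize m) * entryNorm a := by
  rw [← ofReal_norm, ← ENNReal.ofReal_coe_nnreal, ← ENNReal.ofReal_mul (by positivity)]
  exact ENNReal.ofReal_le_ofReal (norm_le_mul_entryNorm a)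

theorem one_le_sqrt_two_mul_maxSize (hm : ∀ l, 0 < m l) : 1 ≤ √2 * (maxSize m : ℝ) := by
  have h1 : (1 : ℝ) ≤ maxSize m := by
    exact_mod_cast (hm 0).trans_le (Finset.le_sup (f := m) (Finset.mem_univ 0))
  have h2 : (1 : ℝ) ≤ √2 := Real.one_le_sqrt.2 (by norm_num)
  nlinarith

/-- The symmetrization of a matrix with prescribed real and imaginary parts is at least as close
to a self-adjoint matrix, for the entry norm, as the given entries. -/
theorem entryNorm_sub_symmetrization_le {c g : MatrixSum m} (hc : star c = c) {ε : ℝ≥0}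
    (h : ∀ l j k, |(c l j k).re - (g l j k).re| ≤ ε ∧ |(c l j k).im - (g l j k).im| ≤ ε) :
    entryNorm (c - (2⁻¹ : ℝ) • (g + star g)) ≤ ε := by
  -- As `c` is its own symmetrization, the error is the average of `c - g` and its adjoint, which
  -- have equal entry norms.
  have h1 : c - (2⁻¹ : ℝ) • (g + star g) = (2⁻¹ : ℝ) • ((c - g) + star (c - g)) := by
    rw [star_sub, hc]
    module
  have h2 : entryNorm (c - g) ≤ ε := entryNorm_le_iff.2 fun l j k => by simpa using h l j k
  have h3 : entryNorm (star (c - g)) ≤ ε := by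
    rwa [entryNorm_star]
  rw [h1]
  refine (entryNorm_smul_le _ _).trans ?_
  calc _ ≤ ‖(2⁻¹ : ℝ)‖₊ * (ε + ε) := by
        gcongr; exact (entryNorm_add_le _ _).trans (add_le_add h2 h3)
    _ = ε := by
      rw [← NNReal.coe_inj]; simp; ring

end EntryNorm

/-! ### The two seminorms: subadditivity, kernel, semicontinuity. -/

section Seminorm

variable {X : Type u} [MetricSpace X] {n : ℕ} {m : Fin (n + 1) → ℕ}

theorem lipConst_le_iff {a : C(X, MatrixSum m)} {c : ℝ≥0∞} :
    lipConst X m a ≤ c ↔ ∀ x y, (entryNorm (a x - a y) : ℝ≥0∞) ≤ c * edist x y := by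
  simp only [lipConst, iSup_le_iff]
  refine forall₂_congr fun x y => ⟨fun h => ?_, fun h hxy => ?_⟩
  · rcases eq_or_ne x y with rfl | hxy
    · simp
    · exact (ENNReal.div_le_iff (edist_pos.2 hxy).ne' (edist_ne_top x y)).1 (h hxy)
  · exact (ENNReal.div_le_iff (edist_pos.2 hxy).ne' (edist_ne_top x y)).2 h

theorem entryNorm_sub_le_lipConst_mul (a : C(X, MatrixSum m)) (x y : X) :
    (entryNorm (a x - a y) : ℝ≥0∞) ≤ lipConst X m a * edist x y :=
  lipConst_le_iff.1 le_rfl x y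

theorem distScalars_le (a : C(X, MatrixSum m)) (r : ℝ) {c : ℝ≥0∞}
    (h : ∀ x, (entryNorm (a x - (r : ℂ) • (1 : MatrixSum m)) : ℝ≥0∞) ≤ c) :
    distScalars X m a ≤ c :=
  iInf_le_of_le r (iSup_le h)

theorem exists_entryNorm_le_of_distScalars_lt {a : C(X, MatrixSum m)} {c : ℝ≥0∞}
    (h : distScalars X m a < c) :
    ∃ r : ℝ, ∀ x, (entryNorm (a x - (r : ℂ) • (1 : MatrixSum m)) : ℝ≥0∞) ≤ c := by
  obtain ⟨r, hr⟩ := iInf_lt_iff.1 h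
  exact ⟨r, fun x => (le_iSup (fun x => (entryNorm (a x - (r : ℂ) • (1 : MatrixSum m)) : ℝ≥0∞))
    x).trans hr.le⟩

theorem lipConst_add_le (a b : C(X, MatrixSum m)) :
    lipConst X m (a + b) ≤ lipConst X m a + lipConst X m b := by
  refine lipConst_le_iff.2 fun x y => ?_
  rw [add_mul]
  refine le_trans ?_ (add_le_add (entryNorm_sub_le_lipConst_mul a x y)
    (entryNorm_sub_le_lipConst_mul b x y))
  rw [← ENNReal.coe_add, ENNReal.coe_le_coe, ContinuousMap.add_apply, ContinuousMap.add_apply,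
    add_sub_add_comm]
  exact entryNorm_add_le _ _

theorem distScalars_add_le (a b : C(X, MatrixSum m)) :
    distScalars X m (a + b) ≤ distScalars X m a + distScalars X m b := by
  refine ENNReal.le_iInf_add_iInf fun r s => distScalars_le _ (r + s) fun x => ?_
  refine le_trans ?_ (add_le_add (le_iSup _ x) (le_iSup _ x))
  rw [← ENNReal.coe_add, ENNReal.coe_le_coe]
  refine le_trans (le_of_eq ?_) (entryNorm_add_le _ _)
  congr 1
  rw [ContinuousMap.add_apply, Complex.ofReal_add, add_smul, add_sub_add_comm]

theorem coe_entryNorm_smul_le (t : ℝ) (a : MatrixSum m) :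
    (entryNorm (t • a) : ℝ≥0∞) ≤ ‖t‖ₑ * entryNorm a := by
  rw [enorm_eq_nnnorm, ← ENNReal.coe_mul]
  exact ENNReal.coe_le_coe.2 (entryNorm_smul_le t a)

theorem lipConst_smul_le (t : ℝ) (a : C(X, MatrixSum m)) :
    lipConst X m (t • a) ≤ ‖t‖ₑ * lipConst X m a := by
  refine lipConst_le_iff.2 fun x y => ?_
  rw [ContinuousMap.smul_apply, ContinuousMap.smul_apply, ← smul_sub, mul_assoc]
  exact (coe_entryNorm_smul_le _ _).trans (mul_le_mul_right (entryNorm_sub_le_lipConst_mul a x y) _)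

theorem distScalars_smul_le (t : ℝ) (a : C(X, MatrixSum m)) :
    distScalars X m (t • a) ≤ ‖t‖ₑ * distScalars X m a := by
  rw [distScalars, distScalars, ENNReal.mul_iInf' (by simp) (fun _ => inferInstance)]
  refine le_iInf fun r => distScalars_le _ (t * r) fun x => ?_
  refine le_trans ?_ (mul_le_mul_right (le_iSup _ x) _)
  refine le_trans (le_of_eq ?_) (coe_entryNorm_smul_le _ _)
  rw [ContinuousMap.smul_apply, smul_sub, Complex.ofReal_mul, mul_smul, Complex.coe_smul]

theorem distScalars_eq_zero_iff [Nonempty X] (hm : ∀ l, 0 < m l) {a : C(X, MatrixSum m)} :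
    distScalars X m a = 0 ↔ ∃ t : ℝ, a = (t : ℂ) • 1 := by
  refine ⟨fun h => ?_, ?_⟩
  · obtain ⟨x₀⟩ := ‹Nonempty X›
    -- Attainment of the infimum is not needed: any scalar `r` within `ε / 2` of `a` is within `ε /
    -- 2` of this diagonal entry, so `t` is within `ε` of `a` for every `ε`.
    refine ⟨(a x₀ 0 ⟨0, hm 0⟩ ⟨0, hm 0⟩).re, ?_⟩
    set t := (a x₀ 0 ⟨0, hm 0⟩ ⟨0, hm 0⟩).re with ht
    have key : ∀ ε : ℝ, 0 < ε → ∀ x l j k, |(a x l j k - t * (1 : MatrixSum m) l j k).re| ≤ ε ∧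
        |(a x l j k - t * (1 : MatrixSum m) l j k).im| ≤ ε := by
      intro ε hε x l j k
      obtain ⟨r, hr⟩ := exists_entryNorm_le_of_distScalars_lt (c := ENNReal.ofReal (ε / 2))
        (a := a) (by rw [h]; simpa using hε)
      have hr' : ∀ x l j k, |(a x l j k - r * (1 : MatrixSum m) l j k).re| ≤ ε / 2 ∧
          |(a x l j k - r * (1 : MatrixSum m) l j k).im| ≤ ε / 2 := by
        intro x l j k
        have h1 := hr x
        rw [ENNReal.ofReal, ENNReal.coe_le_coe, entryNorm_le_iff,
          Real.coe_toNNReal _ (by positivity)] at h1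
        simpa using h1 l j k
      have h0 := (hr' x₀ 0 ⟨0, hm 0⟩ ⟨0, hm 0⟩).1
      have h1 := hr' x l j k
      rcases eq_or_ne j k with rfl | hjk
      · simp [← ht] at h0 h1 ⊢
        refine ⟨?_, by linarith [h1.2]⟩
        rw [abs_le] at h0 h1 ⊢
        constructor <;> linarith
      · simp [hjk] at h1 ⊢
        exact ⟨by linarith [h1.1], by linarith [h1.2]⟩
    ext x l j k
    have h1 := fun ε hε => key ε hε x l j k
    rw [← sub_eq_zero]
    change a x l j k - t * (1 : MatrixSum m) l j k = 0
    refine Complex.ext ?_ ?_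
    · exact abs_eq_zero.1 (le_antisymm (le_of_forall_pos_le_add fun ε hε => by
        simpa using (h1 ε hε).1) (abs_nonneg _))
    · exact abs_eq_zero.1 (le_antisymm (le_of_forall_pos_le_add fun ε hε => by
        simpa using (h1 ε hε).2) (abs_nonneg _))
  · rintro ⟨t, rfl⟩
    refine le_antisymm (distScalars_le _ t fun x => ?_) zero_le
    simp

theorem lipConst_smul_one (t : ℂ) : lipConst X m (t • 1) = 0 :=
  le_antisymm (lipConst_le_iff.2 fun x y => by simp) zero_le

theorem continuous_coe_entryNorm : Continuous fun a : MatrixSum m => (entryNorm a : ℝ≥0∞) := by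
  refine continuous_of_le_add_edist 1 (by simp) fun a b => ?_
  rw [one_mul, edist_eq_enorm_sub]
  refine le_trans ?_ (add_le_add_right (entryNorm_le_enorm (a - b)) _)
  rw [← ENNReal.coe_add, ENNReal.coe_le_coe]
  simpa using entryNorm_add_le b (a - b)

/-- For fixed `x ≠ y` the quotient is continuous in `a`, and a supremum of continuous functions is
lower semicontinuous. -/
theorem lowerSemicontinuous_lipConst : LowerSemicontinuous (lipConst X m) := by
  refine lowerSemicontinuous_iSup fun x => lowerSemicontinuous_iSup fun y =>
    lowerSemicontinuous_iSup fun hxy => Continuous.lowerSemicontinuous ?_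
  refine (ENNReal.continuous_div_const _ (edist_pos.2 hxy).ne').comp
    (continuous_coe_entryNorm.comp ?_)
  exact (continuous_eval_const x).sub (continuous_eval_const y)

variable [CompactSpace X]

theorem distScalars_le_enorm (a : C(X, MatrixSum m)) : distScalars X m a ≤ ‖a‖ₑ := by
  refine distScalars_le _ 0 fun x => ?_
  refine (entryNorm_le_enorm _).trans ?_
  simpa only [Complex.ofReal_zero, zero_smul, sub_zero, enorm_le_iff_norm_le] using
    a.norm_coe_le_norm x

theorem continuous_distScalars : Continuous (distScalars X m) := by
  refine continuous_of_le_add_edist 1 (by simp) fun a b => ?_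
  rw [one_mul, edist_eq_enorm_sub]
  calc distScalars X m a = distScalars X m (b + (a - b)) := by rw [add_sub_cancel]
    _ ≤ _ := (distScalars_add_le _ _).trans (add_le_add_right (distScalars_le_enorm _) _)

/-- Truncating a scalar at `±‖a‖` does not increase its distance to `a`. -/
theorem exists_abs_le_norm_iSup_entryNorm_le (a : C(X, MatrixSum m)) (r : ℝ) :
    ∃ s : ℝ, |s| ≤ ‖a‖ ∧ ∀ x, entryNorm (a x - (s : ℂ) • (1 : MatrixSum m)) ≤
      entryNorm (a x - (r : ℂ) • (1 : MatrixSum m)) := by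
  -- Only the real parts of diagonal entries involve the scalar, and they lie in `[-‖a‖, ‖a‖]`;
  -- projecting `r` onto this interval brings it no farther from any of them.
  refine ⟨max (-‖a‖) (min r ‖a‖), abs_le.2 ⟨le_max_left _ _, max_le (by linarith [norm_nonneg a])
    (min_le_right _ _)⟩, fun x => entryNorm_le_iff.2 fun l j k => ?_⟩
  have h := entryNorm_le_iff.1 (le_refl (entryNorm (a x - (r : ℂ) • (1 : MatrixSum m)))) l j k
  rcases eq_or_ne j k with rfl | hjk
  · have hd : |(a x l j j).re| ≤ ‖a‖ :=
      (abs_re_le_entryNorm (a x) l j j).trans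
        ((NNReal.coe_le_coe.2 (entryNorm_le_nnnorm (a x))).trans (a.norm_coe_le_norm x))
    refine ⟨le_trans ?_ h.1, le_trans (le_of_eq ?_) h.2⟩
    · simp only [Pi.sub_apply, Matrix.sub_apply, Pi.smul_apply, Pi.one_apply, Matrix.smul_apply,
        Matrix.one_apply_eq, smul_eq_mul, mul_one, Complex.sub_re, Complex.ofReal_re]
      rw [abs_le] at hd
      rcases le_total r ‖a‖ with h1 | h1 <;> rcases le_total (-‖a‖) r with h2 | h2
      · simp [h1, h2]
      · rw [min_eq_left h1, max_eq_left h2, abs_of_nonneg (by linarith), abs_of_nonneg (by linarith)]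
        linarith
      · rw [min_eq_right h1, max_eq_right (by linarith), abs_of_nonpos (by linarith),
          abs_of_nonpos (by linarith)]
        linarith
      · have h3 : r = -‖a‖ := by linarith [norm_nonneg a]
        have h4 : r = ‖a‖ := by linarith [norm_nonneg a]
        rw [min_eq_right h1, ← h3, ← h4, max_self]
    · simp
  · simpa [hjk] using h

end Seminorm

/-! ### The quasi-Leibniz inequality for Jordan and Lie products together. -/

section Leibniz

/-- The choices `z = 1 / 2`, `σ = 1` and `z = 1 / (2i)`, `σ = -1` give the Jordan and Lie products.
The differences of `p * q` and of `q * p` are telescoped so that both carry the weights `‖p‖` and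
`‖q'‖`; the factor `‖z‖ = 1 / 2` then averages two equal bounds. -/
theorem norm_smul_mul_add_sub_le {B : Type*} [NormedRing B] [NormedAlgebra ℂ B] {z σ : ℂ}
    (hz : ‖z‖ = 2⁻¹) (hσ : ‖σ‖ = 1) (p q p' q' : B) :
    ‖z • (p * q + σ • (q * p)) - z • (p' * q' + σ • (q' * p'))‖ ≤
      ‖p‖ * ‖q - q'‖ + ‖q'‖ * ‖p - p'‖ := by
  have e : z • (p * q + σ • (q * p)) - z • (p' * q' + σ • (q' * p')) =
      z • ((p * (q - q') + (p - p') * q') + σ • ((q - q') * p + q' * (p - p'))) := by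
    rw [← smul_sub, add_sub_add_comm, ← smul_sub]
    congr 3 <;> noncomm_ring
  rw [e, norm_smul, hz]
  have h1 : ‖(p * (q - q') + (p - p') * q')‖ ≤ ‖p‖ * ‖q - q'‖ + ‖p - p'‖ * ‖q'‖ :=
    (norm_add_le _ _).trans (add_le_add (norm_mul_le _ _) (norm_mul_le _ _))
  have h2 : ‖σ • ((q - q') * p + q' * (p - p'))‖ ≤ ‖q - q'‖ * ‖p‖ + ‖q'‖ * ‖p - p'‖ := by
    rw [norm_smul, hσ, one_mul]
    exact (norm_add_le _ _).trans (add_le_add (norm_mul_le _ _) (norm_mul_le _ _))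
  have h3 := norm_add_le (p * (q - q') + (p - p') * q') (σ • ((q - q') * p + q' * (p - p')))
  linarith

theorem enorm_smul_mul_add_sub_le {B : Type*} [NormedRing B] [NormedAlgebra ℂ B] {z σ : ℂ}
    (hz : ‖z‖ = 2⁻¹) (hσ : ‖σ‖ = 1) (p q p' q' : B) :
    ‖z • (p * q + σ • (q * p)) - z • (p' * q' + σ • (q' * p'))‖ₑ ≤
      ‖p‖ₑ * ‖q - q'‖ₑ + ‖q'‖ₑ * ‖p - p'‖ₑ := by
  simp only [enorm_eq_nnnorm, ← ENNReal.coe_mul, ← ENNReal.coe_add, ENNReal.coe_le_coe]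
  exact norm_smul_mul_add_sub_le hz hσ p q p' q'

variable {X : Type u} [MetricSpace X] [CompactSpace X] {n : ℕ} {m : Fin (n + 1) → ℕ}

theorem enorm_apply_le (a : C(X, MatrixSum m)) (x : X) : ‖a x‖ₑ ≤ ‖a‖ₑ := by
  simpa only [enorm_le_iff_norm_le] using a.norm_coe_le_norm x

theorem lipConst_twisted_product_le {z σ : ℂ} (hz : ‖z‖ = 2⁻¹) (hσ : ‖σ‖ = 1)
    (a b : C(X, MatrixSum m)) :
    lipConst X m (z • (a * b + σ • (b * a))) ≤ ENNReal.ofReal (√2 * maxSize m) *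
      (‖a‖ₑ * lipConst X m b + ‖b‖ₑ * lipConst X m a) := by
  refine lipConst_le_iff.2 fun x y => ?_
  set C := ENNReal.ofReal (√2 * maxSize m)
  calc _ ≤ ‖a x‖ₑ * ‖b x - b y‖ₑ + ‖b y‖ₑ * ‖a x - a y‖ₑ :=
        (entryNorm_le_enorm _).trans (enorm_smul_mul_add_sub_le hz hσ (a x) (b x) (a y) (b y))
    _ ≤ ‖a‖ₑ * (C * (lipConst X m b * edist x y)) + ‖b‖ₑ * (C * (lipConst X m a * edist x y)) := by
        gcongr
        · exact enorm_apply_le a x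
        · exact (enorm_le_mul_entryNorm _).trans
            (mul_le_mul_right (entryNorm_sub_le_lipConst_mul b x y) _)
        · exact enorm_apply_le b y
        · exact (enorm_le_mul_entryNorm _).trans
            (mul_le_mul_right (entryNorm_sub_le_lipConst_mul a x y) _)
    _ = _ := by ring

/-- The product is compared with that of nearby scalars `r` and `s'`, which is the scalar `z * (1 +
σ) * r * s'`; `hreal` makes it an admissible real one. Truncating `s` to `s'` keeps the weight of
the second term below `‖b‖`. -/
theorem distScalars_twisted_product_le {z σ : ℂ} (hz : ‖z‖ = 2⁻¹) (hσ : ‖σ‖ = 1)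
    (hreal : (z * (1 + σ)).im = 0) (a b : C(X, MatrixSum m)) :
    distScalars X m (z • (a * b + σ • (b * a))) ≤ ENNReal.ofReal (√2 * maxSize m) *
      (‖a‖ₑ * distScalars X m b + ‖b‖ₑ * distScalars X m a) := by
  set C := ENNReal.ofReal (√2 * maxSize m) with hC
  have hne : ∀ c : C(X, MatrixSum m), C * ‖c‖ₑ = ∞ → False := fun c h => by
    simp [hC, ENNReal.mul_eq_top] at h
  rw [mul_add, ← mul_assoc, ← mul_assoc, distScalars, distScalars, distScalars,
    ENNReal.mul_iInf' (fun h => (hne _ h).elim) (fun _ => inferInstance),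
    ENNReal.mul_iInf' (fun h => (hne _ h).elim) (fun _ => inferInstance)]
  refine ENNReal.le_iInf_add_iInf fun s r => ?_
  obtain ⟨s', hs', hs⟩ := exists_abs_le_norm_iSup_entryNorm_le b s
  refine distScalars_le _ ((z * (1 + σ)).re * (r * s')) fun x => ?_
  have hcast : (((z * (1 + σ)).re * (r * s') : ℝ) : ℂ) = z * (1 + σ) * (r * s') := by
    push_cast
    congr 1
    exact Complex.ext (by simp) (by simpa using hreal.symm)
  have e : (((z * (1 + σ)).re * (r * s') : ℝ) : ℂ) • (1 : MatrixSum m) =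
      z • (((r : ℂ) • (1 : MatrixSum m)) * ((s' : ℂ) • (1 : MatrixSum m)) +
        σ • (((s' : ℂ) • (1 : MatrixSum m)) * ((r : ℂ) • (1 : MatrixSum m)))) := by
    rw [hcast]
    simp only [smul_mul_assoc, mul_smul_comm, one_mul]
    module
  have hs1 : ‖(s' : ℂ) • (1 : MatrixSum m)‖ₑ ≤ ‖b‖ₑ := by
    rw [enorm_le_iff_norm_le, norm_smul, Complex.norm_real, Real.norm_eq_abs]
    refine (mul_le_of_le_one_right (abs_nonneg _) ?_).trans hs'
    refine (pi_norm_le_iff_of_nonneg zero_le_one).2 fun l => ?_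
    rcases isEmpty_or_nonempty (Fin (m l)) with h | h
    · rw [Subsingleton.elim ((1 : MatrixSum m) l) 0, norm_zero]
      exact zero_le_one
    · simp
  rw [e]
  calc _ ≤ ‖a x‖ₑ * ‖b x - (s' : ℂ) • (1 : MatrixSum m)‖ₑ +
          ‖(s' : ℂ) • (1 : MatrixSum m)‖ₑ * ‖a x - (r : ℂ) • (1 : MatrixSum m)‖ₑ :=
        (entryNorm_le_enorm _).trans (enorm_smul_mul_add_sub_le hz hσ (a x) (b x) _ _)
    _ ≤ ‖a‖ₑ * (C * entryNorm (b x - (s : ℂ) • (1 : MatrixSum m))) +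
          ‖b‖ₑ * (C * entryNorm (a x - (r : ℂ) • (1 : MatrixSum m))) := by
        gcongr
        · exact enorm_apply_le a x
        · refine (enorm_le_mul_entryNorm _).trans ?_
          gcongr
          exact hs x
        · exact enorm_le_mul_entryNorm _
    _ = C * ‖a‖ₑ * entryNorm (b x - (s : ℂ) • (1 : MatrixSum m)) +
          C * ‖b‖ₑ * entryNorm (a x - (r : ℂ) • (1 : MatrixSum m)) := by ring
    _ ≤ _ := by
        gcongr
        · exact le_iSup (fun x => (entryNorm (b x - (s : ℂ) • (1 : MatrixSum m)) : ℝ≥0∞)) x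
        · exact le_iSup (fun x => (entryNorm (a x - (r : ℂ) • (1 : MatrixSum m)) : ℝ≥0∞)) x

theorem lip_twisted_product_le {z σ : ℂ} (hz : ‖z‖ = 2⁻¹) (hσ : ‖σ‖ = 1)
    (hreal : (z * (1 + σ)).im = 0) (a b : C(X, MatrixSum m)) :
    max (lipConst X m (z • (a * b + σ • (b * a)))) (distScalars X m (z • (a * b + σ • (b * a)))) ≤
      ENNReal.ofReal (√2 * maxSize m) * (‖a‖ₑ * max (lipConst X m b) (distScalars X m b) +
        ‖b‖ₑ * max (lipConst X m a) (distScalars X m a)) := by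
  refine max_le ((lipConst_twisted_product_le hz hσ a b).trans ?_)
    ((distScalars_twisted_product_le hz hσ hreal a b).trans ?_)
  · gcongr <;> exact le_max_left _ _
  · gcongr <;> exact le_max_right _ _

end Leibniz

/-! ### Lipschitz approximation and Arzelà-Ascoli. -/

section Approximation

variable {X : Type u} [MetricSpace X] {n : ℕ} {m : Fin (n + 1) → ℕ}

/-- Lipschitz prescriptions for the entries give a self-adjoint function, with the same Lipschitz
constant, that is as close to every self-adjoint matrix as the prescribed entries. -/
theorem exists_selfAdjoint_of_lipschitzWith {K : ℝ≥0}
    {u v : ∀ l : Fin (n + 1), Fin (m l) → Fin (m l) → X → ℝ}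
    (hu : ∀ l j k, LipschitzWith K (u l j k)) (hv : ∀ l j k, LipschitzWith K (v l j k)) :
    ∃ b : C(X, MatrixSum m), star b = b ∧ lipConst X m b ≤ K ∧
      ∀ (x : X) (c : MatrixSum m) (ε : ℝ≥0), star c = c →
        (∀ l j k, |(c l j k).re - u l j k x| ≤ ε ∧ |(c l j k).im - v l j k x| ≤ ε) →
        entryNorm (c - b x) ≤ ε := by
  let g : X → MatrixSum m := fun x l => Matrix.of fun j k => ⟨u l j k x, v l j k x⟩
  have hg : Continuous g := by
    refine continuous_pi fun l => continuous_matrix fun j k => ?_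
    have : (fun x => g x l j k) = fun x => (u l j k x : ℂ) + (v l j k x : ℂ) * Complex.I := by
      funext x
      exact (Complex.re_add_im _).symm
    rw [this]
    exact (Complex.continuous_ofReal.comp (hu l j k).continuous).add
      ((Complex.continuous_ofReal.comp (hv l j k).continuous).mul continuous_const)
  refine ⟨⟨fun x => (2⁻¹ : ℝ) • (g x + star (g x)), by fun_prop⟩, ?_, ?_, ?_⟩
  · ext1 x
    change star ((2⁻¹ : ℝ) • (g x + star (g x))) = (2⁻¹ : ℝ) • (g x + star (g x))
    rw [star_smul, star_add, star_star, star_trivial, add_comm (star (g x))]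
  · refine lipConst_le_iff.2 fun x y => ?_
    rw [edist_nndist, ← ENNReal.coe_mul, ENNReal.coe_le_coe]
    -- With `c = 0` the symmetrization estimate says that symmetrizing does not increase the entry
    -- norm of the increment `g y - g x`.
    have h := entryNorm_sub_symmetrization_le (c := 0) (g := g y - g x) (star_zero _)
      (ε := K * nndist x y) (fun l j k => by
        have h1 := (hu l j k).dist_le_mul x y
        have h2 := (hv l j k).dist_le_mul x y
        rw [Real.dist_eq] at h1 h2
        simpa [g] using ⟨h1, h2⟩)
    refine le_trans (le_of_eq ?_) h
    congr 1
    change (2⁻¹ : ℝ) • (g x + star (g x)) - (2⁻¹ : ℝ) • (g y + star (g y)) = _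
    rw [star_sub]
    module
  · intro x c ε hc h
    exact entryNorm_sub_symmetrization_le hc h

variable [CompactSpace X]

/-- Lipschitz functions are uniformly dense among the continuous real functions on a compact
metric space. -/
theorem exists_lipschitzWith_abs_sub_le {f : X → ℝ} (hf : Continuous f) {ε : ℝ} (hε : 0 < ε) :
    ∃ (K : ℝ≥0) (g : X → ℝ), LipschitzWith K g ∧ ∀ x, |f x - g x| ≤ ε := by
  rcases isEmpty_or_nonempty X with hX | hX
  · exact ⟨0, f, fun x => hX.elim x, fun x => hX.elim x⟩
  obtain ⟨δ, hδ, hfδ⟩ := Metric.uniformContinuous_iff.1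
    (CompactSpace.uniformContinuous_of_continuous hf) ε hε
  let F : C(X, ℝ) := ⟨f, hf⟩
  have hM : ∀ x, |f x| ≤ ‖F‖ := fun x => F.norm_coe_le_norm x
  -- The approximant is the inf-convolution `⨅ y, f y + K * dist x y`. With this slope the penalty
  -- beyond distance `δ` exceeds the oscillation `2 * ‖F‖`, and below `δ` uniform continuity
  -- applies.
  set K : ℝ≥0 := ⟨2 * ‖F‖ / δ, by positivity⟩ with hK
  have hKδ : (K : ℝ) * δ = 2 * ‖F‖ := by
    rw [hK]; change 2 * ‖F‖ / δ * δ = _; field_simp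
  have hlow : ∀ x y, f x - ε ≤ f y + K * dist x y := by
    intro x y
    rcases lt_or_ge (dist x y) δ with h | h
    · have h1 := (abs_lt.1 (Real.dist_eq (f x) (f y) ▸ hfδ h)).2
      have h2 : 0 ≤ (K : ℝ) * dist x y := by positivity
      linarith
    · have h1 : (K : ℝ) * δ ≤ K * dist x y := by gcongr
      linarith [(abs_le.1 (hM x)).2, (abs_le.1 (hM y)).1]
  have hbdd : ∀ x, BddBelow (Set.range fun y => f y + K * dist x y) := fun x =>
    ⟨f x - ε, by rintro _ ⟨y, rfl⟩; exact hlow x y⟩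
  refine ⟨K, fun x => ⨅ y, f y + K * dist x y, LipschitzWith.of_le_add_mul K fun x y => ?_,
    fun x => abs_le.2 ⟨?_, ?_⟩⟩
  · rw [← sub_le_iff_le_add]
    refine le_ciInf fun z => ?_
    have h1 := ciInf_le (hbdd x) z
    have h2 : (K : ℝ) * dist x z ≤ K * (dist x y + dist y z) := by
      gcongr; exact dist_triangle _ _ _
    linarith
  · have h1 := ciInf_le (hbdd x) x
    simp only [dist_self, mul_zero, add_zero] at h1
    linarith
  · have h1 := le_ciInf (hlow x)
    linarith

theorem distScalars_lt_top (a : C(X, MatrixSum m)) : distScalars X m a < ∞ :=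
  (distScalars_le_enorm a).trans_lt enorm_lt_top

theorem dense_lipConst_lt_top :
    Dense {a : selfAdjoint C(X, MatrixSum m) |
      max (lipConst X m (a : C(X, MatrixSum m))) (distScalars X m (a : C(X, MatrixSum m))) < ∞} := by
  rw [Metric.dense_iff]
  intro a ε hε
  -- The summand `1` keeps `R` positive even if all the matrix sizes are zero.
  set R := √2 * (maxSize m : ℝ) + 1 with hR
  have hR0 : 0 < R := by positivity
  set η : ℝ≥0 := ⟨ε / (2 * R), by positivity⟩ with hη
  have hη0 : (0 : ℝ) < η := by change 0 < ε / (2 * R); positivity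
  have hre : ∀ i : (Σ l : Fin (n + 1), Fin (m l) × Fin (m l)),
      Continuous fun x => ((a : C(X, MatrixSum m)) x i.1 i.2.1 i.2.2).re := fun i =>
    Complex.continuous_re.comp (((continuous_apply i.1).comp
      (a : C(X, MatrixSum m)).continuous).matrix_elem i.2.1 i.2.2)
  have him : ∀ i : (Σ l : Fin (n + 1), Fin (m l) × Fin (m l)),
      Continuous fun x => ((a : C(X, MatrixSum m)) x i.1 i.2.1 i.2.2).im := fun i =>
    Complex.continuous_im.comp (((continuous_apply i.1).comp
      (a : C(X, MatrixSum m)).continuous).matrix_elem i.2.1 i.2.2)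
  choose Ku u hu hu' using fun i => exists_lipschitzWith_abs_sub_le (hre i) hη0
  choose Kv v hv hv' using fun i => exists_lipschitzWith_abs_sub_le (him i) hη0
  obtain ⟨K, hK⟩ := Finite.exists_le fun i => max (Ku i) (Kv i)
  obtain ⟨b, hb, hbK, hbc⟩ := exists_selfAdjoint_of_lipschitzWith (K := K)
    (u := fun l j k => u ⟨l, j, k⟩) (v := fun l j k => v ⟨l, j, k⟩)
    (fun l j k => (hu _).weaken ((le_max_left _ _).trans (hK _)))
    (fun l j k => (hv _).weaken ((le_max_right _ _).trans (hK _)))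
  refine ⟨⟨b, hb⟩, ?_, max_lt (hbK.trans_lt ENNReal.coe_lt_top) (distScalars_lt_top _)⟩
  rw [Metric.mem_ball, dist_comm]
  change dist (a : C(X, MatrixSum m)) b < ε
  refine lt_of_le_of_lt ((ContinuousMap.dist_le (half_pos hε).le).2 fun x => ?_) (half_lt_self hε)
  have hax : star ((a : C(X, MatrixSum m)) x) = (a : C(X, MatrixSum m)) x :=
    congrArg (fun f : C(X, MatrixSum m) => f x) a.2
  have h1 : entryNorm ((a : C(X, MatrixSum m)) x - b x) ≤ η :=
    hbc x _ η hax fun l j k => ⟨hu' ⟨l, j, k⟩ x, hv' ⟨l, j, k⟩ x⟩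
  rw [dist_eq_norm]
  calc _ ≤ √2 * maxSize m * entryNorm ((a : C(X, MatrixSum m)) x - b x) := norm_le_mul_entryNorm _
    _ ≤ R * η := by
        gcongr
        linarith
    _ = ε / 2 := by
        change R * (ε / (2 * R)) = _
        field_simp

/-- Arzelà-Ascoli for bounded continuous functions, pulled back along the isometry with `C(X, E)`;
compactness of the closure is enough. -/
theorem totallyBounded_lipschitz_bounded {E : Type*} [NormedAddCommGroup E] [ProperSpace E]
    (C : ℝ≥0) (R : ℝ) :
    TotallyBounded {f : C(X, E) | LipschitzWith C f ∧ ∀ x, ‖f x‖ ≤ R} := by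
  let T : Set (BoundedContinuousFunction X E) := {f | LipschitzWith C f ∧ ∀ x, ‖f x‖ ≤ R}
  have hT : IsCompact (closure T) := by
    refine BoundedContinuousFunction.arzela_ascoli (Metric.closedBall 0 R)
      (isCompact_closedBall 0 R) T (fun f x hf => by simpa using hf.2 x) ?_
    exact (LipschitzWith.uniformEquicontinuous _ C fun f => f.2.1).equicontinuous
  have h := totallyBounded_preimage
    (ContinuousMap.isometryEquivBoundedOfCompact X E).isometry.isUniformInducing
    (hT.totallyBounded.subset subset_closure)
  exact h.subset fun f hf => hf

end Approximation

/-! ### The maximum of the two seminorms is a quasi-Leibniz Lip-norm. -/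

section LipNorm

variable {X : Type u} [MetricSpace X] {n : ℕ} {m : Fin (n + 1) → ℕ}

theorem lip_smul_le (t : ℝ) (a : C(X, MatrixSum m)) :
    max (lipConst X m (t • a)) (distScalars X m (t • a)) ≤
      ‖t‖ₑ * max (lipConst X m a) (distScalars X m a) :=
  max_le ((lipConst_smul_le t a).trans (mul_le_mul_right (le_max_left _ _) _))
    ((distScalars_smul_le t a).trans (mul_le_mul_right (le_max_right _ _) _))

theorem lip_smul (t : ℝ) (a : C(X, MatrixSum m)) :
    max (lipConst X m (t • a)) (distScalars X m (t • a)) =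
      ‖t‖ₑ * max (lipConst X m a) (distScalars X m a) := by
  refine le_antisymm (lip_smul_le t a) ?_
  rcases eq_or_ne t 0 with rfl | ht
  · simp
  · have h := lip_smul_le t⁻¹ (t • a)
    rw [smul_smul, inv_mul_cancel₀ ht, one_smul] at h
    calc _ ≤ ‖t‖ₑ * (‖t⁻¹‖ₑ * max (lipConst X m (t • a)) (distScalars X m (t • a))) := by gcongr
      _ = _ := by
        rw [← mul_assoc, ← enorm_mul, mul_inv_cancel₀ ht, enorm_one, one_mul]

/-- The elements of the Lip-ball are, up to scalars, uniformly bounded and equi-Lipschitz. -/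
theorem exists_sub_smul_one_mem {a : C(X, MatrixSum m)}
    (ha : max (lipConst X m a) (distScalars X m a) ≤ 1) :
    ∃ r : ℝ, a - (r : ℂ) • 1 ∈ {f : C(X, MatrixSum m) |
      LipschitzWith (√2 * (maxSize m : ℝ)).toNNReal f ∧ ∀ x, ‖f x‖ ≤ √2 * maxSize m * 2} := by
  -- Any bound above `1` would do: the infimum over scalars is not assumed to be attained.
  obtain ⟨r, hr⟩ := exists_entryNorm_le_of_distScalars_lt (c := ((2 : ℝ≥0) : ℝ≥0∞)) (a := a)
    (((le_max_right _ _).trans ha).trans_lt (by norm_num))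
  refine ⟨r, fun x y => ?_, fun x => ?_⟩
  · rw [edist_eq_enorm_sub]
    calc _ = ‖a x - a y‖ₑ := by simp
      _ ≤ ENNReal.ofReal (√2 * maxSize m) * entryNorm (a x - a y) := enorm_le_mul_entryNorm _
      _ ≤ ENNReal.ofReal (√2 * maxSize m) * (1 * edist x y) := by
        gcongr
        exact lipConst_le_iff.1 ((le_max_left _ _).trans ha) x y
      _ = _ := by rw [one_mul]; rfl
  · refine (norm_le_mul_entryNorm _).trans ?_
    gcongr
    exact_mod_cast ENNReal.coe_le_coe.1 (hr x)

variable (X m) in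
/-- The seminorm of `homogeneous X m`, on the self-adjoint part of `C(X, MatrixSum m)`. -/
noncomputable def homogeneousLip (a : selfAdjoint C(X, MatrixSum m)) : ℝ≥0∞ :=
  max (lipConst X m a) (distScalars X m a)

/-- The kernel is decided by `distScalars` alone, because `lipConst` vanishes on the scalars. -/
theorem homogeneousLip_eq_zero_iff [Nonempty X] (hm : ∀ l, 0 < m l)
    (a : selfAdjoint C(X, MatrixSum m)) :
    homogeneousLip X m a = 0 ↔ ∃ t : ℝ, a = t • (1 : selfAdjoint C(X, MatrixSum m)) := by
  have h1 : (∃ t : ℝ, a = t • (1 : selfAdjoint C(X, MatrixSum m))) ↔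
      ∃ t : ℝ, (a : C(X, MatrixSum m)) = (t : ℂ) • (1 : C(X, MatrixSum m)) := by
    refine exists_congr fun t => Subtype.ext_iff.trans ?_
    have h2 : (t : ℂ) • (1 : C(X, MatrixSum m)) = t • (1 : C(X, MatrixSum m)) := by
      ext x l j k
      simp
    rw [h2, selfAdjoint.val_smul, selfAdjoint.val_one]
  rw [h1, ← distScalars_eq_zero_iff hm]
  refine ⟨fun h => le_antisymm ((le_max_right _ _).trans h.le) zero_le, fun h => ?_⟩
  obtain ⟨t, ht⟩ := (distScalars_eq_zero_iff hm).1 h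
  refine le_antisymm (max_le ?_ h.le) zero_le
  rw [ht, lipConst_smul_one]

variable [CompactSpace X]

theorem homogeneousLip_jordan_le (a b : selfAdjoint C(X, MatrixSum m)) :
    homogeneousLip X m (jordan a b) ≤ ENNReal.ofReal (√2 * maxSize m) *
      (‖(a : C(X, MatrixSum m))‖ₑ * homogeneousLip X m b +
        ‖(b : C(X, MatrixSum m))‖ₑ * homogeneousLip X m a) := by
  have h := lip_twisted_product_le (X := X) (m := m) (z := 2⁻¹) (σ := 1) (by simp) (by simp)
    (by norm_num) a b
  rw [one_smul] at h
  exact h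

theorem homogeneousLip_lie_le (a b : selfAdjoint C(X, MatrixSum m)) :
    homogeneousLip X m (lie a b) ≤ ENNReal.ofReal (√2 * maxSize m) *
      (‖(a : C(X, MatrixSum m))‖ₑ * homogeneousLip X m b +
        ‖(b : C(X, MatrixSum m))‖ₑ * homogeneousLip X m a) := by
  have h := lip_twisted_product_le (X := X) (m := m) (z := (2 * Complex.I)⁻¹) (σ := -1)
    (by simp) (by simp) (by norm_num) a b
  have e : (-1 : ℂ) • ((b : C(X, MatrixSum m)) * a) = -((b : C(X, MatrixSum m)) * a) := by
    ext x l j k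
    simp
  rw [e, ← sub_eq_add_neg] at h
  exact h

theorem lowerSemicontinuous_homogeneousLip : LowerSemicontinuous (homogeneousLip X m) :=
  (lowerSemicontinuous_lipConst.comp continuous_subtype_val).sup
    (continuous_distScalars.comp continuous_subtype_val).lowerSemicontinuous

theorem isQuasiLeibnizLipNorm_homogeneousLip [Nonempty X] (hm : ∀ l, 0 < m l) :
    IsQuasiLeibnizLipNorm (√2 * maxSize m) 0 (homogeneousLip X m) := by
  have hproper : ProperSpace (MatrixSum m) := FiniteDimensional.proper ℂ _
  have hsmul : ∀ (t : ℝ) (a : selfAdjoint C(X, MatrixSum m)),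
      homogeneousLip X m (t • a) = ‖t‖ₑ * homogeneousLip X m a := fun t a => lip_smul t a.1
  have hK := totallyBounded_lipschitz_bounded (X := X) (E := MatrixSum m)
    (√2 * (maxSize m : ℝ)).toNNReal (√2 * maxSize m * 2)
  have hLK := fun (a : selfAdjoint C(X, MatrixSum m)) (ha : homogeneousLip X m a ≤ 1) =>
    exists_sub_smul_one_mem ha
  exact
    { add_le := fun a b => max_le
        ((lipConst_add_le a.1 b.1).trans (add_le_add (le_max_left _ _) (le_max_left _ _)))
        ((distScalars_add_le a.1 b.1).trans (add_le_add (le_max_right _ _) (le_max_right _ _)))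
      smul := hsmul
      dense_dom := dense_lipConst_lt_top
      eq_zero_iff := homogeneousLip_eq_zero_iff hm
      mkDist_ne_top := mkDist_ne_top_of_totallyBounded hK hLK
      nhds_basis := nhds_basis_of_totallyBounded hsmul dense_lipConst_lt_top hK hLK
      lsc := lowerSemicontinuous_homogeneousLip
      one_le := one_le_sqrt_two_mul_maxSize hm
      nonneg := le_rfl
      leibniz := fun a b _ _ => by
        rw [ENNReal.ofReal_zero, zero_mul, zero_mul, add_zero]
        exact max_le (homogeneousLip_jordan_le a b) (homogeneousLip_lie_le a b) }

variable (X) in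
/-- The seminorm of `homogeneous X m` is a `(√2 · maxSize m, 0)`-quasi-Leibniz Lip-norm. -/
theorem isQuasiLeibnizLipNorm_homogeneous [Nonempty X] (hm : ∀ l, 0 < m l) :
    IsQuasiLeibnizLipNorm (√2 * maxSize m) 0 (homogeneous X m).lip :=
  isQuasiLeibnizLipNorm_homogeneousLip hm

end LipNorm

/-! ### Extension from subsets, the bridge of nearby pairs, and finite nets. -/

section FiniteApproximation

variable {X : Type u} [MetricSpace X] {n : ℕ} {m : Fin (n + 1) → ℕ}

/-- A `1`-Lipschitz function on a subset that nearly takes values in `[-1, 1]` is nearly the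
restriction of a `1`-Lipschitz function with values in `[-1, 1]`. -/
theorem exists_lipschitzWith_abs_le_one {s : Set X} {f : s → ℝ} (hf : LipschitzWith 1 f) {η : ℝ}
    (hη : 0 ≤ η) (hf1 : ∀ y, |f y| ≤ 1 + η) :
    ∃ g : X → ℝ, LipschitzWith 1 g ∧ (∀ x, |g x| ≤ 1) ∧ ∀ y : s, |f y - g y| ≤ η := by
  have hext : ∀ y : s, Function.extend Subtype.val f 0 (y : X) = f y :=
    fun y => Subtype.val_injective.extend_apply f 0 y
  have hF : LipschitzOnWith 1 (Function.extend Subtype.val f 0) s := by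
    intro x hx y hy
    rw [hext ⟨x, hx⟩, hext ⟨y, hy⟩]
    exact hf ⟨x, hx⟩ ⟨y, hy⟩
  -- McShane's extension may leave `[-1, 1]` away from `s`. Clamping keeps it `1`-Lipschitz and, on
  -- `s`, moves values by at most `η`.
  obtain ⟨g, hg, hgs⟩ := hF.extend_real
  refine ⟨fun x => max (-1) (min 1 (g x)), (hg.const_min 1).const_max (-1),
    fun x => abs_le.2 ⟨le_max_left _ _, max_le (by norm_num) (min_le_left _ _)⟩, fun y => ?_⟩
  dsimp only
  rw [← hgs y.2, hext]
  have h := abs_le.1 (hf1 y)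
  rcases le_total 1 (f y) with h1 | h1 <;> rcases le_total (-1) (f y) with h2 | h2
  · rw [min_eq_left h1, max_eq_right (by norm_num), abs_le]; constructor <;> linarith
  · linarith
  · rw [min_eq_right h1, max_eq_right h2, sub_self, abs_zero]; exact hη
  · rw [min_eq_right h1, max_eq_left h2, abs_le]; constructor <;> linarith

theorem lipschitzWith_one_re_entry {Y : Type u} [MetricSpace Y] {a : C(Y, MatrixSum m)}
    (ha : lipConst Y m a ≤ 1) (l j k) (t : ℝ) : LipschitzWith 1 fun y => (a y l j k).re - t := by
  refine LipschitzWith.of_dist_le_mul fun x y => ?_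
  have h := lipConst_le_iff.1 ha x y
  rw [one_mul, edist_nndist, ENNReal.coe_le_coe] at h
  rw [NNReal.coe_one, one_mul, Real.dist_eq, sub_sub_sub_cancel_right]
  exact (abs_re_le_entryNorm (a x - a y) l j k).trans h

theorem lipschitzWith_one_im_entry {Y : Type u} [MetricSpace Y] {a : C(Y, MatrixSum m)}
    (ha : lipConst Y m a ≤ 1) (l j k) : LipschitzWith 1 fun y => (a y l j k).im := by
  refine LipschitzWith.of_dist_le_mul fun x y => ?_
  have h := lipConst_le_iff.1 ha x y
  rw [one_mul, edist_nndist, ENNReal.coe_le_coe] at h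
  rw [NNReal.coe_one, one_mul, Real.dist_eq]
  exact (abs_im_le_entryNorm (a x - a y) l j k).trans h

/-- Elements of the Lip-ball over a subset are nearly restrictions of elements of the Lip-ball. -/
theorem exists_extension_lip_le_one {s : Set X} {a : C(s, MatrixSum m)} (hsa : star a = a)
    (ha : max (lipConst s m a) (distScalars s m a) ≤ 1) {η : ℝ≥0} (hη : 0 < η) :
    ∃ b : C(X, MatrixSum m), star b = b ∧ max (lipConst X m b) (distScalars X m b) ≤ 1 ∧
      ∀ y : s, entryNorm (a y - b y) ≤ η := by
  have ha1 := (le_max_left _ _).trans ha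
  obtain ⟨r, hr⟩ := exists_entryNorm_le_of_distScalars_lt (c := ((1 + η : ℝ≥0) : ℝ≥0∞)) (a := a)
    (((le_max_right _ _).trans ha).trans_lt (by
      rw [← ENNReal.coe_one, ENNReal.coe_lt_coe]; exact lt_add_of_pos_right 1 hη))
  -- The entries of the scalar `r` are subtracted before extending, so that clamping at `1` gives
  -- `distScalars ≤ 1`; they are added back in `b`. The slack `η` in `hr` is there because the
  -- infimum need not be attained.
  let t : ∀ l : Fin (n + 1), Fin (m l) → Fin (m l) → ℝ := fun l j k => if j = k then r else 0
  have ht : ∀ l j k, (((r : ℂ) • (1 : MatrixSum m)) l j k) = (t l j k : ℂ) := by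
    intro l j k
    rcases eq_or_ne j k with rfl | hjk
    · simp [t]
    · simp [t, hjk]
  have hr' : ∀ y l j k, |(a y l j k).re - t l j k| ≤ 1 + η ∧ |(a y l j k).im| ≤ 1 + η := by
    intro y l j k
    have h := entryNorm_le_iff.1 (ENNReal.coe_le_coe.1 (hr y)) l j k
    rw [Pi.sub_apply, Matrix.sub_apply, ht] at h
    simpa using h
  choose u hu hu1 hua using fun l j k => exists_lipschitzWith_abs_le_one
    (lipschitzWith_one_re_entry ha1 l j k (t l j k)) η.2 (fun y => (hr' y l j k).1)
  choose v hv hv1 hva using fun l j k => exists_lipschitzWith_abs_le_one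
    (lipschitzWith_one_im_entry ha1 l j k) η.2 (fun y => (hr' y l j k).2)
  obtain ⟨b, hb, hb1, hbc⟩ := exists_selfAdjoint_of_lipschitzWith (K := 1)
    (u := fun l j k x => t l j k + u l j k x) (v := v)
    (fun l j k => by simpa using (LipschitzWith.const (t l j k)).add (hu l j k)) hv
  refine ⟨b, hb, max_le (by simpa using hb1) (distScalars_le _ r fun x => ?_), fun y => ?_⟩
  · rw [entryNorm_sub_comm, ← ENNReal.coe_one, ENNReal.coe_le_coe]
    refine hbc x _ 1 (by simp) fun l j k => ?_
    rw [ht]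
    simpa using ⟨hu1 l j k x, hv1 l j k x⟩
  · refine hbc y _ η (congrArg (fun f : C(s, MatrixSum m) => f y) hsa) fun l j k => ⟨?_, hva l j k y⟩
    rw [← sub_sub]
    exact hua l j k y

theorem lip_comp_subtype_val_le (s : Set X) (b : C(X, MatrixSum m)) :
    max (lipConst s m (b.comp ⟨Subtype.val, continuous_subtype_val⟩))
      (distScalars s m (b.comp ⟨Subtype.val, continuous_subtype_val⟩)) ≤
      max (lipConst X m b) (distScalars X m b) := by
  refine max_le_max (lipConst_le_iff.2 fun x y => entryNorm_sub_le_lipConst_mul b x y) ?_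
  exact iInf_mono fun r => iSup_le fun x =>
    le_iSup (fun x => (entryNorm (b x - (r : ℂ) • (1 : MatrixSum m)) : ℝ≥0∞)) (x : X)

/-- Pullbacks to a common space that are pointwise close for the entry norm are close in norm. -/
theorem edist_comp_le {Y Z : Type u} [MetricSpace Y] [MetricSpace Z] [CompactSpace Z]
    {a : C(Y, MatrixSum m)} {b : C(X, MatrixSum m)} {p : C(Z, Y)} {q : C(Z, X)} {η : ℝ≥0}
    (h : ∀ z, entryNorm (a (p z) - b (q z)) ≤ η) :
    edist (a.comp p) (b.comp q) ≤ ENNReal.ofReal (√2 * maxSize m) * η := by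
  rw [← ENNReal.ofReal_coe_nnreal, ← ENNReal.ofReal_mul (by positivity), edist_dist]
  refine ENNReal.ofReal_le_ofReal ((ContinuousMap.dist_le (by positivity)).2 fun z => ?_)
  rw [dist_eq_norm]
  refine (norm_le_mul_entryNorm _).trans ?_
  gcongr
  exact h z

theorem finiteDimensional_homogeneous (s : Finset X) :
    FiniteDimensional ℂ (homogeneous s m).carrier := by
  let f : C(s, MatrixSum m) →ₗ[ℂ] (s → MatrixSum m) :=
    { toFun := fun a => a, map_add' := fun _ _ => rfl, map_smul' := fun _ _ => rfl }
  have hf : Function.Injective f := fun a b h => ContinuousMap.ext fun x => congrFun h x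
  exact FiniteDimensional.of_injective f hf

variable [CompactSpace X]

/-- The pairs of points of `s` and `X` at distance at most `δ`. -/
abbrev Near (s : Set X) (δ : ℝ) : Type u := {p : s × X // dist (p.1 : X) p.2 ≤ δ}

theorem compactSpace_near (s : Set X) [CompactSpace s] (δ : ℝ) : CompactSpace (Near s δ) := by
  refine isCompact_iff_compactSpace.1 (IsClosed.isCompact ?_)
  exact isClosed_le ((continuous_subtype_val.comp continuous_fst).dist continuous_snd)
    continuous_const

theorem nontrivial_continuousMap {Z : Type u} [TopologicalSpace Z] [Nonempty Z]
    (hm : ∀ l, 0 < m l) : Nontrivial C(Z, MatrixSum m) := by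
  have _ : Nonempty (Fin (m 0)) := ⟨⟨0, hm 0⟩⟩
  infer_instance

/-- The bridge with unit pivot given by the functions on the pairs of nearby points. -/
noncomputable def nearBridge (hm : ∀ l, 0 < m l) (s : Set X) [CompactSpace s] [Nonempty s]
    {δ : ℝ} (hδ : 0 ≤ δ) (hs : ∀ x, ∃ y : s, dist (y : X) x ≤ δ) :
    Bridge (homogeneous s m).carrier (homogeneous X m).carrier :=
  have _ : CompactSpace (Near s δ) := compactSpace_near s δ
  { space := C(Near s δ, MatrixSum m)
    pivot := 1
    levelOne_nonempty := by
      have _ : Nonempty (Near s δ) :=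
        ⟨⟨(Classical.arbitrary s, Classical.arbitrary s), by simpa using hδ⟩⟩
      have _ := nontrivial_continuousMap (Z := Near s δ) hm
      rw [levelOne_one]
      exact Set.nonempty_iff_univ_nonempty.1 stateSpace_nonempty
    left := ContinuousMap.compStarAlgHom' ℂ (MatrixSum m)
      ⟨fun z : Near s δ => z.1.1, by fun_prop⟩
    right := ContinuousMap.compStarAlgHom' ℂ (MatrixSum m)
      ⟨fun z : Near s δ => z.1.2, by fun_prop⟩
    -- Both projections are onto: the diagonal pairs `(y, y)` reach every point of `s`, and `hs`
    -- provides a partner for every point of `X`.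
    left_injective := fun a b h => by
      refine ContinuousMap.ext fun y => ?_
      exact congrArg (fun f : C(Near s δ, MatrixSum m) => f ⟨(y, y), by simpa using hδ⟩) h
    right_injective := fun a b h => by
      refine ContinuousMap.ext fun x => ?_
      obtain ⟨y, hy⟩ := hs x
      exact congrArg (fun f : C(Near s δ, MatrixSum m) => f ⟨(y, x), hy⟩) h }

theorem edist_nearBridge (hm : ∀ l, 0 < m l) (s : Set X) [CompactSpace s] [Nonempty s]
    {δ : ℝ} [CompactSpace (Near s δ)] (hδ : 0 ≤ δ) (hs : ∀ x, ∃ y : s, dist (y : X) x ≤ δ)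
    (a : C(s, MatrixSum m)) (b : C(X, MatrixSum m)) :
    edist ((nearBridge hm s hδ hs).left a * (nearBridge hm s hδ hs).pivot)
      ((nearBridge hm s hδ hs).pivot * (nearBridge hm s hδ hs).right b) =
    edist (a.comp ⟨fun z : Near s δ => z.1.1, by fun_prop⟩)
      (b.comp ⟨fun z : Near s δ => z.1.2, by fun_prop⟩) :=
  congrArg₂ edist (mul_one _) (one_mul _)

theorem length_nearBridge_le (hm : ∀ l, 0 < m l) (s : Set X) [CompactSpace s] [Nonempty s] {δ : ℝ≥0}
    (hδ : 0 < δ) (hs : ∀ x, ∃ y : s, dist (y : X) x ≤ δ) :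
    (nearBridge hm s δ.coe_nonneg hs).length ≤ ENNReal.ofReal (√2 * maxSize m) * (δ + δ : ℝ≥0) := by
  have _ : CompactSpace (Near s δ) := compactSpace_near s δ
  have hnear : ∀ b : C(X, MatrixSum m), lipConst X m b ≤ 1 → ∀ z : Near s δ,
      entryNorm (b (z.1.1 : X) - b z.1.2) ≤ δ := by
    intro b hb z
    have h := lipConst_le_iff.1 hb (z.1.1 : X) z.1.2
    rw [one_mul, edist_nndist, ENNReal.coe_le_coe] at h
    exact h.trans z.2
  rw [Bridge.length, height_eq_zero_of_pivot_eq_one _ rfl, max_eq_left zero_le]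
  refine Metric.hausdorffEDist_le_of_mem_edist ?_ ?_
  · rintro _ ⟨_, ⟨⟨a, hsa⟩, ha, rfl⟩, rfl⟩
    change C(s, MatrixSum m) at a
    -- One `δ` pays for the extension error on `s`, the other for moving from `z.1.1` to the nearby
    -- point `z.1.2`.
    obtain ⟨b, hb, hb1, hab⟩ := exists_extension_lip_le_one (a := a) hsa ha hδ
    refine ⟨_, ⟨b, ⟨⟨b, hb⟩, hb1, rfl⟩, rfl⟩, ?_⟩
    refine (edist_nearBridge hm s δ.coe_nonneg hs a b).trans_le ?_
    refine edist_comp_le (a := a) (b := b) fun z => ?_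
    have h := entryNorm_add_le (a z.1.1 - b z.1.1) (b z.1.1 - b z.1.2)
    rw [sub_add_sub_cancel] at h
    exact h.trans (add_le_add (hab _) (hnear b ((le_max_left _ _).trans hb1) z))
  · rintro _ ⟨_, ⟨⟨b, hb⟩, hb1, rfl⟩, rfl⟩
    change C(X, MatrixSum m) at b
    -- Restriction is exact on `s`, so this direction uses only one `δ`.
    let a : C(s, MatrixSum m) := b.comp ⟨Subtype.val, continuous_subtype_val⟩
    have ha : star a = a := by
      ext1 y
      exact congrArg (fun f : C(X, MatrixSum m) => f y) hb
    refine ⟨_, ⟨a, ⟨⟨a, ha⟩, (lip_comp_subtype_val_le s b).trans hb1, rfl⟩, rfl⟩, ?_⟩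
    rw [edist_comm]
    refine (edist_nearBridge hm s δ.coe_nonneg hs a b).trans_le ?_
    refine edist_comp_le (a := a) (b := b) fun z => ?_
    exact (hnear b ((le_max_left _ _).trans hb1) z).trans le_self_add

theorem propinquity_homogeneous_le (hm : ∀ l, 0 < m l) (s : Set X) [CompactSpace s] [Nonempty s]
    {δ : ℝ≥0} (hδ : 0 < δ) (hs : ∀ x, ∃ y : s, dist (y : X) x ≤ δ) :
    propinquity (homogeneous s m) (homogeneous X m) ≤
      ENNReal.ofReal (√2 * maxSize m) * (δ + δ : ℝ≥0) := by
  have _ : Nonempty X := ⟨(Classical.arbitrary s : s)⟩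
  exact (iInf_le _ (Trek.single ⟨_, _, isQuasiLeibnizLipNorm_homogeneous s hm⟩
    ⟨_, _, isQuasiLeibnizLipNorm_homogeneous X hm⟩ (nearBridge hm s δ.coe_nonneg hs))).trans
    (length_nearBridge_le hm s hδ hs)

theorem exists_finset_net (δ : ℝ≥0) (hδ : 0 < δ) :
    ∃ s : Finset X, ∀ x, ∃ y : s, dist (y : X) x ≤ δ := by
  obtain ⟨t, -, ht, hX⟩ := (isCompact_univ (X := X)).finite_cover_balls
    (NNReal.coe_pos.2 hδ)
  refine ⟨ht.toFinset, fun x => ?_⟩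
  obtain ⟨y, hy, hxy⟩ := Set.mem_iUnion₂.1 (hX (Set.mem_univ x))
  exact ⟨⟨y, ht.mem_toFinset.2 hy⟩, by rw [dist_comm]; exact (Metric.mem_ball.1 hxy).le⟩

end FiniteApproximation

end QuantumMetric

theorem mainTheorem6 {X : Type u} [MetricSpace X] [CompactSpace X] [Nonempty X]
    {n : ℕ} (m : Fin (n + 1) → ℕ) (hm : ∀ l, 0 < m l) :
    ∃ S : ℕ → Finset X,
      (∀ k, (S k).Nonempty) ∧
      (∀ k, FiniteDimensional ℂ (QuantumMetric.homogeneous (S k) m).carrier) ∧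
      (∀ k, QuantumMetric.IsQuasiLeibnizLipNorm (√2 * QuantumMetric.maxSize m) 0
        (QuantumMetric.homogeneous (S k) m).lip) ∧
      QuantumMetric.IsQuasiLeibnizLipNorm (√2 * QuantumMetric.maxSize m) 0
        (QuantumMetric.homogeneous X m).lip ∧
      Tendsto (fun k => QuantumMetric.propinquity (QuantumMetric.homogeneous (S k) m)
        (QuantumMetric.homogeneous X m)) atTop (𝓝 0) := by
  have hpos : ∀ k : ℕ, 0 < (1 / ((k : ℝ≥0) + 1)) := fun k => by positivity
  choose S hS using fun k : ℕ => QuantumMetric.exists_finset_net (X := X) _ (hpos k)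
  have hne : ∀ k, Nonempty (S k) := fun k => ⟨(hS k (Classical.arbitrary X)).choose⟩
  refine ⟨S, fun k => Finset.nonempty_coe_sort.1 (hne k),
    fun k => QuantumMetric.finiteDimensional_homogeneous (S k),
    fun k => QuantumMetric.isQuasiLeibnizLipNorm_homogeneous (S k) hm,
    QuantumMetric.isQuasiLeibnizLipNorm_homogeneous X hm, ?_⟩
  refine tendsto_of_tendsto_of_tendsto_of_le_of_le tendsto_const_nhds ?_ (fun _ => zero_le)
    fun k => QuantumMetric.propinquity_homogeneous_le hm (S k : Set X) (hpos k) (hS k)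
  have h1 : Tendsto (fun k : ℕ => 1 / ((k : ℝ≥0) + 1)) atTop (𝓝 0) :=
    tendsto_one_div_add_atTop_nhds_zero_nat
  have h2 := ENNReal.Tendsto.const_mul (a := ENNReal.ofReal (√2 * QuantumMetric.maxSize m))
    (ENNReal.tendsto_coe.2 (h1.add h1)) (Or.inr ENNReal.ofReal_ne_top)
  simpa using h2
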